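/- There is a universal constant $L>0$ such that the following holds. Let $n\in\mathbb N$, let $(a_{ijk})_{1\le i,j,k\le n}$ be real numbers, let $p\ge 1$ be real, and let $T\subset (B_2^n+\sqrt p\,B_1^n)\times(B_2^n+\sqrt p\,B_1^n)$, where $B_2^n=\{x\in\mathbb R^n:\sum_i x_i^2\le 1\}$ and $B_1^n=\{x\in\mathbb R^n:\sum_i|x_i|\le 1\}$. Then there are an integer $0\le N\le e^{Lp}$, nonempty sets $T_1,\dots,T_N\subset\mathbb R^n\times\mathbb R^n$ and points $(x_1,y_1),\dots,(x_N,y_N)\in T$ (where $x_l,y_l\in\mathbb R^n$) such that $$T=\bigcup_{l=1}^N\big(T_l+(x_l,y_l)\big)$$ and, for every $l\le N$ and every $z=(z_1,\dots,z_n)\in\mathbb R^n$, $$\mathbb E\sup_{(x,y)\in T_l}\sum_{i,j,k}a_{ijk}x_iy_jz_kg_k\le\frac{L}{\sqrt p}\Big(\sum_{i,j,k}a_{ijk}^2z_k^4\Big)^{1/4}\Big(\sum_{i,j,k}a_{ijk}^2\Big)^{1/4},$$ where $g_1,\dots,g_n$ are independent standard Gaussian random variables; here the suprema are finite and the random variable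 on the left is integrable. In particular the decomposition does not depend on $z$. -/

import Mathlib

open MeasureTheory ProbabilityTheory
open scoped Pointwise

namespace ChaosPartition

/-- The closed Euclidean unit ball `B_2^n` of `ℝⁿ` (vectors are plain coordinate functions). -/
def ballTwo (n : ℕ) : Set (Fin n → ℝ) := {x | ∑ i, x i ^ 2 ≤ 1}

/-- The closed unit ball `B_1^n` of `ℝⁿ` for the `ℓ¹` norm. -/
def ballOne (n : ℕ) : Set (Fin n → ℝ) := {x | ∑ i, |x i| ≤ 1}

/-- The Minkowski sum `B_2^n + √p B_1^n`. -/
noncomputable def mixedBall (n : ℕ) (p : ℝ) : Set (Fin n → ℝ) :=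
  ballTwo n + Real.sqrt p • ballOne n

/-- The standard Gaussian measure on `ℝⁿ`: the law of `n` independent `N(0,1)` variables. -/
noncomputable def gaussianVec (n : ℕ) : Measure (Fin n → ℝ) :=
  Measure.pi fun _ => gaussianReal 0 1

/-- The sum `∑_{ijk} a_{ijk} x_i y_j z_k g_k`, for a pair `v = (x, y)`. -/
def chaos {n : ℕ} (a : Fin n → Fin n → Fin n → ℝ) (z g : Fin n → ℝ)
    (v : (Fin n → ℝ) × (Fin n → ℝ)) : ℝ :=
  ∑ i, ∑ j, ∑ k, a i j k * v.1 i * v.2 j * z k * g k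

/-- `sup_{(x,y) ∈ S} ∑_{ijk} a_{ijk} x_i y_j z_k g_k`, as a function of `g`. -/
noncomputable def supChaos {n : ℕ} (a : Fin n → Fin n → Fin n → ℝ) (z : Fin n → ℝ)
    (S : Set ((Fin n → ℝ) × (Fin n → ℝ))) (g : Fin n → ℝ) : ℝ :=
  sSup (chaos a z g '' S)

end ChaosPartition

namespace ChaosPartition

/-! ### The symmetric exponential distribution -/

/-! The proof is a PAC-Bayesian argument with a product Laplace prior. The relative entropy of the
Laplace vector translated by `u + v`, with respect to the untranslated one, is at most `|u|_2² +
|v|_1`, which is the geometry of `B_2 + √p B_1`. Hence, for a pair of Laplace vectors scaled by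
`1/√p`, translating by any point of the relevant set costs only `O(p)`
(`integral_pairCost_sqrt_smul_le`).

This cost is used twice through the Donsker-Varadhan inequality
`exp_integral_sub_integral_pairCost_le`. The first use is a volume bound: a neighbourhood in which
the smoothed point lands with probability at least one half has prior mass at least `exp(-26p)`, so
a maximal disjoint family of such neighbourhoods gives a net of size `exp(26p)`
(`exists_finset_net_of_integral_le`). The second use is a bound on the Gaussian supremum
(`mul_chaos_sub_le`): the exponential functional averaged over the prior has Gaussian mean 1 and
does not involve the point of the cell, so it controls all points of the cell simultaneously.

To make the partition independent of `z`, closeness is measured by `∑_k r_k⁴ / s_k`, where `s_k` is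
the squared Hilbert-Schmidt norm of the `k`-th slice. By Cauchy-Schwarz, `∑ z_k² r_k²` is at most
`(∑ z_k⁴ s_k)^(1/2) (∑ r_k⁴ / s_k)^(1/2)`, for every `z`.

Two nets are needed because smoothing a bilinear form at `w` produces cross terms linear in each
component of `w`. With `A = ∑ s_k`, the first net (`exists_first_net`) recentres `T` so that the row
and column semi-norms of `w` are `O(A/p²)`; every smoothing term is then `O(A/p⁴)`, and the second
net (`exists_second_net`) brings the bilinear images in a cell to that distance from a reference
image. On such a cell the smoothed variance is `O(√(ZA)/p²)`, with `Z = ∑ z_k⁴ s_k`, and optimising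
the exponential parameter gives the bound `(ZA)^(1/4)/√p` up to a constant (`supChaos_cell`). -/

/-- The symmetric exponential (Laplace) distribution, with density `exp (-|x|) / 2`. -/
noncomputable def laplace : Measure ℝ :=
  volume.withDensity fun x => ENNReal.ofReal (Real.exp (-|x|) / 2)

lemma lintegral_laplace (f : ℝ → ENNReal) (hf : Measurable f) :
    ∫⁻ x, f x ∂laplace = ∫⁻ x, ENNReal.ofReal (Real.exp (-|x|) / 2) * f x := by
  rw [laplace, lintegral_withDensity_eq_lintegral_mul _ (by fun_prop) hf]
  rfl

lemma integral_laplace (f : ℝ → ℝ) :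
    ∫ x, f x ∂laplace = ∫ x, Real.exp (-|x|) / 2 * f x := by
  rw [laplace, integral_withDensity_eq_integral_toReal_smul (by fun_prop) (by simp)]
  refine integral_congr_ae (Filter.Eventually.of_forall fun x => ?_)
  simp only [smul_eq_mul]
  rw [ENNReal.toReal_ofReal (by positivity)]

lemma integrable_laplace_iff (f : ℝ → ℝ) :
    Integrable f laplace ↔ Integrable fun x => Real.exp (-|x|) / 2 * f x := by
  rw [laplace, integrable_withDensity_iff_integrable_smul' (by fun_prop) (by simp)]
  refine integrable_congr (Filter.Eventually.of_forall fun x => ?_)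
  simp only [smul_eq_mul]
  rw [ENNReal.toReal_ofReal (by positivity)]

lemma integrable_exp_mul_laplace_and {s : ℝ} (hs : |s| < 1) :
    Integrable (fun x => Real.exp (s * x)) laplace ∧
      ∫ x, Real.exp (s * x) ∂laplace = 1 / (1 - s ^ 2) := by
  obtain ⟨h1, h2⟩ := abs_lt.1 hs
  have hIic : Set.EqOn (fun x => Real.exp (-|x|) / 2 * Real.exp (s * x))
      (fun x => Real.exp ((1 + s) * x) / 2) (Set.Iic 0) := by
    intro x hx
    simp only [abs_of_nonpos (Set.mem_Iic.1 hx)]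
    rw [div_mul_eq_mul_div, ← Real.exp_add]
    ring_nf
  have hIoi : Set.EqOn (fun x => Real.exp (-|x|) / 2 * Real.exp (s * x))
      (fun x => Real.exp ((s - 1) * x) / 2) (Set.Ioi 0) := by
    intro x hx
    simp only [abs_of_pos (Set.mem_Ioi.1 hx)]
    rw [div_mul_eq_mul_div, ← Real.exp_add]
    ring_nf
  have i1 : IntegrableOn (fun x => Real.exp (-|x|) / 2 * Real.exp (s * x)) (Set.Iic 0) :=
    IntegrableOn.congr_fun (Integrable.div_const
      (integrableOn_exp_mul_Iic (by linarith : 0 < 1 + s) 0) 2) hIic.symm measurableSet_Iic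
  have i2 : IntegrableOn (fun x => Real.exp (-|x|) / 2 * Real.exp (s * x)) (Set.Ioi 0) :=
    IntegrableOn.congr_fun (Integrable.div_const
      (integrableOn_exp_mul_Ioi (by linarith : s - 1 < 0) 0) 2) hIoi.symm measurableSet_Ioi
  have i3 : Integrable (fun x => Real.exp (-|x|) / 2 * Real.exp (s * x)) := by
    rw [← integrableOn_univ, ← Set.Iic_union_Ioi (a := (0 : ℝ))]
    exact i1.union i2
  refine ⟨(integrable_laplace_iff _).2 i3, ?_⟩
  rw [integral_laplace, ← setIntegral_univ, ← Set.Iic_union_Ioi (a := (0 : ℝ)),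
    setIntegral_union (Set.Iic_disjoint_Ioi le_rfl) measurableSet_Ioi i1 i2,
    setIntegral_congr_fun measurableSet_Iic hIic, setIntegral_congr_fun measurableSet_Ioi hIoi,
    integral_div, integral_div, integral_exp_mul_Iic (by linarith), integral_exp_mul_Ioi
    (by linarith)]
  have e1 : 1 + s ≠ 0 := by linarith
  have e2 : s - 1 ≠ 0 := by linarith
  have e3 : 1 - s ^ 2 ≠ 0 := by nlinarith
  simp only [mul_zero, Real.exp_zero]
  field_simp
  ring

instance isProbabilityMeasure_laplace : IsProbabilityMeasure laplace := by
  obtain ⟨h1, h2⟩ := integrable_exp_mul_laplace_and (s := 0) (by simp)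
  simp only [zero_mul, Real.exp_zero] at h1 h2
  have : IsFiniteMeasure laplace := by
    have := (integrable_const_iff (c := (1 : ℝ))).1 h1
    simpa using this
  refine ⟨?_⟩
  simp only [integral_const, smul_eq_mul, mul_one] at h2
  rw [← ENNReal.toReal_eq_one_iff]
  simpa [Measure.real] using h2

lemma lintegral_laplace_shift (f : ℝ → ENNReal) (hf : Measurable f) (s : ℝ) :
    ∫⁻ x, f x ∂laplace
      = ∫⁻ x, f (x + s) * ENNReal.ofReal (Real.exp (-(|x + s| - |x|))) ∂laplace := by
  rw [lintegral_laplace f hf, lintegral_laplace _ (by fun_prop),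
    ← lintegral_add_right_eq_self (μ := volume) _ s]
  refine lintegral_congr fun x => ?_
  rw [mul_comm (f _), ← mul_assoc, ← ENNReal.ofReal_mul (by positivity), div_mul_eq_mul_div,
    ← Real.exp_add]
  ring_nf

lemma measurePreserving_neg_laplace : MeasurePreserving (fun x : ℝ => -x) laplace laplace := by
  refine ⟨measurable_neg, ?_⟩
  refine Measure.ext_of_lintegral _ fun f hf => ?_
  rw [lintegral_map hf measurable_neg, lintegral_laplace f hf, lintegral_laplace _ (by fun_prop),
    ← lintegral_neg_eq_self (μ := volume)]
  simp

/-- By symmetry of the law, the integrand may be averaged with its value at `-s`. The second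
difference `|x+s| + |x-s| - 2|x|` vanishes for `|x| > |s|` and is at most `2|s|` elsewhere, and
`[-|s|, |s|]` has mass at most `|s|`. This turns the obvious linear bound into a quadratic one. -/
lemma integral_abs_add_sub_abs_laplace_le (s : ℝ) :
    ∫ x, (|x + s| - |x|) ∂laplace ≤ s ^ 2 := by
  have hint (s : ℝ) : Integrable (fun x : ℝ => |x + s| - |x|) laplace :=
    Integrable.of_bound (C := |s|) (by fun_prop) (Filter.Eventually.of_forall fun x => by
      have := abs_abs_sub_abs_le_abs_sub (x + s) x
      simpa using this)
  have hneg : ∫ x, (|x + s| - |x|) ∂laplace = ∫ x, (|x + -s| - |x|) ∂laplace := by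
    rw [← measurePreserving_neg_laplace.integral_comp' (f := MeasurableEquiv.neg ℝ)]
    refine integral_congr_ae (Filter.Eventually.of_forall fun x => ?_)
    simp only [MeasurableEquiv.neg_apply, abs_neg]
    rw [← abs_neg (-x + s)]
    ring_nf
  have hind : Integrable (Set.indicator (Set.Icc (-|s|) |s|) fun _ : ℝ => 2 * |s|) laplace :=
    (integrable_const _).indicator measurableSet_Icc
  have hmeas : laplace.real (Set.Icc (-|s|) |s|) ≤ |s| := by
    rw [measureReal_def, laplace, withDensity_apply _ measurableSet_Icc]
    refine ENNReal.toReal_le_of_le_ofReal (abs_nonneg s) ?_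
    calc ∫⁻ x in Set.Icc (-|s|) |s|, ENNReal.ofReal (Real.exp (-|x|) / 2)
        ≤ ∫⁻ x in Set.Icc (-|s|) |s|, ENNReal.ofReal (1 / 2) := by
          refine lintegral_mono fun x => ENNReal.ofReal_le_ofReal ?_
          have : Real.exp (-|x|) ≤ 1 := Real.exp_le_one_iff.2 (by simp)
          linarith
      _ = ENNReal.ofReal |s| := by
          rw [lintegral_const, Measure.restrict_apply_univ, Real.volume_Icc,
            ← ENNReal.ofReal_mul (by norm_num)]
          ring_nf
  have hsum : 2 * ∫ x, (|x + s| - |x|) ∂laplace ≤ 2 * s ^ 2 := by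
    calc 2 * ∫ x, (|x + s| - |x|) ∂laplace
        = ∫ x, ((|x + s| - |x|) + (|x + -s| - |x|)) ∂laplace := by
          rw [integral_add (hint s) (hint (-s)), ← hneg]
          ring
      _ ≤ ∫ x, Set.indicator (Set.Icc (-|s|) |s|) (fun _ : ℝ => 2 * |s|) x ∂laplace := by
          refine integral_mono ((hint s).add (hint (-s))) hind fun x => ?_
          by_cases hx : x ∈ Set.Icc (-|s|) |s|
          · simp only [Set.indicator_of_mem hx]
            have h1 := abs_add_le x s
            have h2 := abs_add_le x (-s)
            rw [abs_neg] at h2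
            linarith
          · simp only [Set.indicator_of_notMem hx]
            have : |s| < |x| := by
              by_contra hcon
              exact hx (Set.mem_Icc.2 (abs_le.1 (not_lt.1 hcon)))
            rcases abs_cases x with ⟨h1, h1'⟩ | ⟨h1, h1'⟩ <;>
            rcases abs_cases s with ⟨h2, h2'⟩ | ⟨h2, h2'⟩ <;>
            rcases abs_cases (x + s) with ⟨h3, h3'⟩ | ⟨h3, h3'⟩ <;>
            rcases abs_cases (x + -s) with ⟨h4, h4'⟩ | ⟨h4, h4'⟩ <;> linarith
      _ = laplace.real (Set.Icc (-|s|) |s|) * (2 * |s|) := by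
          rw [integral_indicator_const _ measurableSet_Icc, smul_eq_mul]
      _ ≤ |s| * (2 * |s|) := by gcongr
      _ = 2 * s ^ 2 := by rw [← sq_abs s]; ring
  linarith

/-- The shift `u + v` costs at most `u² + |v|`. -/
lemma integral_abs_add_add_sub_abs_laplace_le (u v : ℝ) :
    ∫ x, (|x + (u + v)| - |x|) ∂laplace ≤ u ^ 2 + |v| := by
  have hint (s : ℝ) : Integrable (fun x : ℝ => |x + s| - |x|) laplace :=
    Integrable.of_bound (C := |s|) (by fun_prop) (Filter.Eventually.of_forall fun x => by
      have := abs_abs_sub_abs_le_abs_sub (x + s) x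
      simpa using this)
  calc ∫ x, (|x + (u + v)| - |x|) ∂laplace
      ≤ ∫ x, ((|x + u| - |x|) + |v|) ∂laplace := by
        refine integral_mono (hint _) ((hint u).add (integrable_const _)) fun x => ?_
        have := abs_add_le (x + u) v
        simp only
        rw [← add_assoc]
        linarith
    _ = ∫ x, (|x + u| - |x|) ∂laplace + |v| := by
        rw [integral_add (hint u) (integrable_const _)]; simp
    _ ≤ u ^ 2 + |v| := by gcongr; exact integral_abs_add_sub_abs_laplace_le u

/-- The law of `n` independent symmetric exponential variables. -/
noncomputable def laplaceVec (n : ℕ) : Measure (Fin n → ℝ) := Measure.pi fun _ => laplace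

instance isProbabilityMeasure_laplaceVec (n : ℕ) : IsProbabilityMeasure (laplaceVec n) := by
  unfold laplaceVec; infer_instance

/-- The logarithmic density cost of translating the symmetric exponential law by `s`. -/
noncomputable def shiftCost {n : ℕ} (s x : Fin n → ℝ) : ℝ := ∑ i, (|x i + s i| - |x i|)

@[fun_prop]
lemma measurable_shiftCost {n : ℕ} (s : Fin n → ℝ) : Measurable (shiftCost s) := by
  unfold shiftCost; fun_prop

lemma abs_shiftCost_le {n : ℕ} (s x : Fin n → ℝ) : |shiftCost s x| ≤ ∑ i, |s i| := by
  refine (Finset.abs_sum_le_sum_abs _ _).trans (Finset.sum_le_sum fun i _ => ?_)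
  simpa using abs_abs_sub_abs_le_abs_sub (x i + s i) (x i)

lemma integrable_shiftCost {n : ℕ} (s : Fin n → ℝ) : Integrable (shiftCost s) (laplaceVec n) :=
  Integrable.of_bound (C := ∑ i, |s i|) (measurable_shiftCost s).aestronglyMeasurable
    (Filter.Eventually.of_forall fun x => abs_shiftCost_le s x)

/-- It suffices to identify two measures on boxes, where independence factors the integral into
one-dimensional shifts. -/
lemma lintegral_laplaceVec_shift {n : ℕ} (s : Fin n → ℝ) (f : (Fin n → ℝ) → ENNReal)
    (hf : Measurable f) :
    ∫⁻ x, f x ∂laplaceVec n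
      = ∫⁻ x, f (x + s) * ENNReal.ofReal (Real.exp (-shiftCost s x)) ∂laplaceVec n := by
  have hD : Measurable fun x : Fin n → ℝ => ENNReal.ofReal (Real.exp (-shiftCost s x)) := by
    fun_prop
  have hprod (x : Fin n → ℝ) : ENNReal.ofReal (Real.exp (-shiftCost s x))
      = ∏ i, ENNReal.ofReal (Real.exp (-(|x i + s i| - |x i|))) := by
    rw [shiftCost, ← Finset.sum_neg_distrib, Real.exp_sum,
      ENNReal.ofReal_prod_of_nonneg fun i _ => (Real.exp_pos _).le]
  have key : laplaceVec n = ((laplaceVec n).withDensity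
      fun x => ENNReal.ofReal (Real.exp (-shiftCost s x))).map (fun x => x + s) := by
    refine Measure.pi_eq fun B hB => ?_
    have hm : Measurable fun x : Fin n → ℝ => x + s := by fun_prop
    rw [Measure.map_apply hm (MeasurableSet.univ_pi hB),
      withDensity_apply _ (hm (MeasurableSet.univ_pi hB)),
      ← lintegral_indicator (hm (MeasurableSet.univ_pi hB))]
    have hX (i : Fin n) : Measurable fun y : ℝ => (B i).indicator 1 (y + s i)
        * ENNReal.ofReal (Real.exp (-(|y + s i| - |y|))) := by
      refine Measurable.mul ?_ (by fun_prop)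
      exact (measurable_const.indicator (hB i)).comp (measurable_id.add_const _)
    have hind := iIndepFun_pi (μ := fun _ : Fin n => laplace)
      (X := fun i y => (B i).indicator 1 (y + s i)
        * ENNReal.ofReal (Real.exp (-(|y + s i| - |y|)))) fun i => (hX i).aemeasurable
    have := lintegral_prod_eq_prod_lintegral_of_indepFun Finset.univ _ hind
      fun i => (hX i).comp (measurable_pi_apply i)
    calc _ = ∫⁻ x, ∏ i, ((B i).indicator 1 (x i + s i)
        * ENNReal.ofReal (Real.exp (-(|x i + s i| - |x i|)))) ∂laplaceVec n := by
          refine lintegral_congr fun x => ?_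
          rw [Finset.prod_mul_distrib, ← hprod]
          by_cases hx : ∀ i, x i + s i ∈ B i
          · rw [Set.indicator_of_mem (by simpa using hx),
              Finset.prod_congr rfl fun i _ => Set.indicator_of_mem (hx i) _]
            simp
          · rw [Set.indicator_of_notMem (by simpa using hx)]
            push Not at hx
            obtain ⟨i, hi⟩ := hx
            rw [Finset.prod_eq_zero (Finset.mem_univ i) (Set.indicator_of_notMem hi _), zero_mul]
      _ = ∏ i, ∫⁻ y, (B i).indicator 1 (y + s i)
            * ENNReal.ofReal (Real.exp (-(|y + s i| - |y|))) ∂laplace := by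
          rw [laplaceVec, this]
          refine Finset.prod_congr rfl fun i _ => ?_
          exact (measurePreserving_eval (fun _ : Fin n => laplace) i).lintegral_comp (hX i)
      _ = ∏ i, laplace (B i) := by
          refine Finset.prod_congr rfl fun i _ => ?_
          rw [← lintegral_indicator_one (hB i),
            lintegral_laplace_shift _ (measurable_one.indicator (hB i)) (s i)]
  conv_lhs => rw [key]
  rw [lintegral_map hf (by fun_prop), lintegral_withDensity_eq_lintegral_mul _ hD (by fun_prop)]
  refine lintegral_congr fun x => ?_
  simp [mul_comm]

lemma integral_shiftCost_le {n : ℕ} (u v : Fin n → ℝ) :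
    ∫ x, shiftCost (u + v) x ∂laplaceVec n ≤ ∑ i, u i ^ 2 + ∑ i, |v i| := by
  have hint (s : ℝ) : Integrable (fun x : ℝ => |x + s| - |x|) laplace :=
    Integrable.of_bound (C := |s|) (by fun_prop) (Filter.Eventually.of_forall fun x => by
      have := abs_abs_sub_abs_le_abs_sub (x + s) x
      simpa using this)
  unfold shiftCost laplaceVec
  have hint' (i : Fin n) : Integrable (fun x : Fin n → ℝ => |x i + (u + v) i| - |x i|)
      (Measure.pi fun _ => laplace) :=
    integrable_comp_eval (μ := fun _ : Fin n => laplace) (f := fun y => |y + (u + v) i| - |y|)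
      (hint _)
  rw [integral_finsetSum _ fun i _ => hint' i, ← Finset.sum_add_distrib]
  refine Finset.sum_le_sum fun i _ => ?_
  rw [integral_comp_eval (μ := fun _ : Fin n => laplace) (f := fun x => |x + (u + v) i| - |x|)
    (hint _).aestronglyMeasurable]
  exact integral_abs_add_add_sub_abs_laplace_le (u i) (v i)

lemma measurePreserving_neg_laplaceVec (n : ℕ) :
    MeasurePreserving (fun x : Fin n → ℝ => -x) (laplaceVec n) (laplaceVec n) :=
  measurePreserving_pi _ _ fun _ => measurePreserving_neg_laplace

/-! ### Pairs of independent vectors and the change of measure inequality -/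

/-- The law of two independent copies of `laplaceVec`. -/
noncomputable def laplacePair (n : ℕ) : Measure ((Fin n → ℝ) × (Fin n → ℝ)) :=
  (laplaceVec n).prod (laplaceVec n)

instance isProbabilityMeasure_laplacePair (n : ℕ) : IsProbabilityMeasure (laplacePair n) := by
  unfold laplacePair; infer_instance

/-- The logarithmic density cost of translating `laplacePair` by `s`. -/
noncomputable def pairCost {n : ℕ} (s v : (Fin n → ℝ) × (Fin n → ℝ)) : ℝ :=
  shiftCost s.1 v.1 + shiftCost s.2 v.2

lemma integrable_pairCost {n : ℕ} (s : (Fin n → ℝ) × (Fin n → ℝ)) :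
    Integrable (pairCost s) (laplacePair n) :=
  ((integrable_shiftCost s.1).comp_fst _).add ((integrable_shiftCost s.2).comp_snd _)

lemma lintegral_laplacePair_shift {n : ℕ} (s : (Fin n → ℝ) × (Fin n → ℝ))
    (f : (Fin n → ℝ) × (Fin n → ℝ) → ENNReal) (hf : Measurable f) :
    ∫⁻ v, f v ∂laplacePair n
      = ∫⁻ v, f (v + s) * ENNReal.ofReal (Real.exp (-pairCost s v)) ∂laplacePair n := by
  have hm : Measurable fun v : (Fin n → ℝ) × (Fin n → ℝ) =>
      f (v + s) * ENNReal.ofReal (Real.exp (-pairCost s v)) := by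
    unfold pairCost; fun_prop
  unfold laplacePair
  rw [lintegral_prod _ hf.aemeasurable, lintegral_prod _ hm.aemeasurable,
    lintegral_laplaceVec_shift s.1 _ hf.lintegral_prod_right']
  refine lintegral_congr fun x => ?_
  rw [lintegral_laplaceVec_shift s.2 _ (by fun_prop), ← lintegral_mul_const _ (by fun_prop)]
  refine lintegral_congr fun y => ?_
  rw [pairCost, neg_add, Real.exp_add, ENNReal.ofReal_mul (by positivity),
    mul_comm (ENNReal.ofReal (Real.exp (-shiftCost s.1 x))), mul_assoc]
  rfl

/-- The Donsker-Varadhan inequality for a translate of the symmetric exponential law. -/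
lemma exp_integral_sub_integral_pairCost_le {n : ℕ} (s : (Fin n → ℝ) × (Fin n → ℝ))
    (F : (Fin n → ℝ) × (Fin n → ℝ) → ℝ) (hF : Measurable F)
    (hi : Integrable (fun v => F (v + s)) (laplacePair n)) :
    ENNReal.ofReal (Real.exp (∫ v, F (v + s) ∂laplacePair n - ∫ v, pairCost s v ∂laplacePair n))
      ≤ ∫⁻ v, ENNReal.ofReal (Real.exp (F v)) ∂laplacePair n := by
  rw [lintegral_laplacePair_shift s _ (by fun_prop)]
  set m := ∫ v, F (v + s) ∂laplacePair n - ∫ v, pairCost s v ∂laplacePair n with hm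
  have hd : Integrable (fun v => F (v + s) - pairCost s v) (laplacePair n) :=
    hi.sub (integrable_pairCost s)
  have hd' : Integrable (fun v => F (v + s) - pairCost s v - m) (laplacePair n) :=
    hd.sub (integrable_const _)
  -- Jensen's inequality by hand: the integrand is the tangent of `exp` at the mean `m`, whose
  -- integral is exactly `exp m`. Its positive part is still below `exp`, which permits passing to
  -- the lower integral without assuming `exp F` integrable.
  have hG : Integrable (fun v => Real.exp m * (1 + (F (v + s) - pairCost s v - m)))
      (laplacePair n) := ((integrable_const _).add hd').const_mul _
  have hGm : ∫ v, Real.exp m * (1 + (F (v + s) - pairCost s v - m)) ∂laplacePair n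
      = Real.exp m := by
    rw [integral_const_mul, integral_add (integrable_const _) hd',
      integral_sub hd (integrable_const _), integral_sub hi (integrable_pairCost s)]
    simp [← hm]
  rw [← hGm]
  refine (ENNReal.ofReal_le_ofReal (integral_mono hG hG.pos_part fun v => le_max_left _ _)).trans ?_
  rw [ofReal_integral_eq_lintegral_ofReal hG.pos_part
    (Filter.Eventually.of_forall fun v => le_max_right _ _)]
  refine lintegral_mono fun v => ?_
  rw [← ENNReal.ofReal_mul (by positivity), ← Real.exp_add]
  refine ENNReal.ofReal_le_ofReal (max_le ?_ (by positivity))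
  calc Real.exp m * (1 + (F (v + s) - pairCost s v - m))
      ≤ Real.exp m * Real.exp (F (v + s) - pairCost s v - m) := by
        gcongr
        linarith [Real.add_one_le_exp (F (v + s) - pairCost s v - m)]
    _ = Real.exp (F (v + s) + -pairCost s v) := by
        rw [← Real.exp_add]; ring_nf

/-! ### Random variables with moments of all orders -/

/-- Measurable real functions all of whose moments are finite. -/
def AllMoments {Ω : Type*} [MeasurableSpace Ω] (ν : Measure Ω) (f : Ω → ℝ) : Prop :=
  Measurable f ∧ ∀ k : ℕ, Integrable (fun ω => f ω ^ (2 * k)) ν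

section AllMoments

variable {Ω : Type*} [MeasurableSpace Ω] {ν : Measure Ω} {f g : Ω → ℝ}

lemma AllMoments.integrable [IsFiniteMeasure ν] (hf : AllMoments ν f) : Integrable f ν := by
  refine Integrable.mono' ((integrable_const (1 : ℝ)).add (hf.2 1)) hf.1.aestronglyMeasurable
    (Filter.Eventually.of_forall fun ω => ?_)
  simp only [Real.norm_eq_abs, Pi.add_apply, mul_one]
  nlinarith [sq_nonneg (|f ω| - 1), sq_abs (f ω), abs_nonneg (f ω)]

lemma AllMoments.const [IsFiniteMeasure ν] (c : ℝ) : AllMoments ν fun _ => c :=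
  ⟨measurable_const, fun _ => integrable_const _⟩

/-- Since every even moment is available, `(fg)^(2k) ≤ f^(4k) + g^(4k)` suffices, and no
independence is needed. -/
lemma AllMoments.mul (hf : AllMoments ν f) (hg : AllMoments ν g) :
    AllMoments ν fun ω => f ω * g ω := by
  refine ⟨hf.1.mul hg.1, fun k => ?_⟩
  refine Integrable.mono' ((hf.2 (2 * k)).add (hg.2 (2 * k)))
    ((hf.1.mul hg.1).pow_const _).aestronglyMeasurable (Filter.Eventually.of_forall fun ω => ?_)
  have h1 : f ω ^ (2 * (2 * k)) = (f ω ^ (2 * k)) ^ 2 := by rw [← pow_mul]; ring_nf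
  have h2 : g ω ^ (2 * (2 * k)) = (g ω ^ (2 * k)) ^ 2 := by rw [← pow_mul]; ring_nf
  have h3 : 0 ≤ f ω ^ (2 * k) := (even_two_mul k).pow_nonneg _
  have h4 : 0 ≤ g ω ^ (2 * k) := (even_two_mul k).pow_nonneg _
  simp only [Real.norm_eq_abs, Pi.add_apply]
  rw [mul_pow, abs_of_nonneg (by positivity), h1, h2]
  nlinarith [sq_nonneg (f ω ^ (2 * k) - g ω ^ (2 * k)), mul_nonneg h3 h4]

lemma AllMoments.add (hf : AllMoments ν f) (hg : AllMoments ν g) :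
    AllMoments ν fun ω => f ω + g ω := by
  refine ⟨hf.1.add hg.1, fun k => ?_⟩
  refine Integrable.mono' (((hf.2 k).add (hg.2 k)).const_mul (2 ^ (2 * k)))
    ((hf.1.add hg.1).pow_const _).aestronglyMeasurable (Filter.Eventually.of_forall fun ω => ?_)
  simp only [Real.norm_eq_abs, Pi.add_apply]
  have h3 : 0 ≤ f ω ^ (2 * k) := (even_two_mul k).pow_nonneg _
  have h4 : 0 ≤ g ω ^ (2 * k) := (even_two_mul k).pow_nonneg _
  rw [abs_of_nonneg ((even_two_mul k).pow_nonneg _), ← Even.pow_abs (even_two_mul k)]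
  have h5 : |f ω + g ω| ≤ 2 * max |f ω| |g ω| := by
    have := abs_add_le (f ω) (g ω)
    linarith [le_max_left |f ω| |g ω|, le_max_right |f ω| |g ω|]
  refine (pow_le_pow_left₀ (abs_nonneg _) h5 _).trans ?_
  rw [mul_pow]
  gcongr
  rcases max_cases |f ω| |g ω| with ⟨h, _⟩ | ⟨h, _⟩ <;> rw [h, Even.pow_abs (even_two_mul k)] <;>
    linarith

lemma AllMoments.const_mul [IsFiniteMeasure ν] (hf : AllMoments ν f) (c : ℝ) :
    AllMoments ν fun ω => c * f ω := (AllMoments.const c).mul hf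

lemma AllMoments.sub [IsFiniteMeasure ν] (hf : AllMoments ν f) (hg : AllMoments ν g) :
    AllMoments ν fun ω => f ω - g ω := by
  have := hf.add (hg.const_mul (-1))
  simpa [sub_eq_add_neg] using this

lemma AllMoments.pow [IsFiniteMeasure ν] (hf : AllMoments ν f) (m : ℕ) :
    AllMoments ν fun ω => f ω ^ m := by
  induction m with
  | zero => simpa using AllMoments.const 1
  | succ m ih => simpa only [pow_succ] using ih.mul hf

lemma AllMoments.div_const [IsFiniteMeasure ν] (hf : AllMoments ν f) (c : ℝ) :
    AllMoments ν fun ω => f ω / c := by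
  simpa only [div_eq_inv_mul] using hf.const_mul c⁻¹

lemma AllMoments.sum [IsFiniteMeasure ν] {ι : Type*} (s : Finset ι) {F : ι → Ω → ℝ}
    (hF : ∀ i ∈ s, AllMoments ν (F i)) : AllMoments ν fun ω => ∑ i ∈ s, F i ω := by
  classical
  induction s using Finset.induction_on with
  | empty => simpa using AllMoments.const 0
  | insert i s hi ih =>
    simp only [Finset.sum_insert hi]
    exact (hF i (Finset.mem_insert_self i s)).add
      (ih fun j hj => hF j (Finset.mem_insert_of_mem hj))

end AllMoments

lemma even_pow_le_exp_add_exp (k : ℕ) (x : ℝ) :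
    x ^ (2 * k) ≤ 2 ^ (2 * k) * (2 * k).factorial
      * (Real.exp (1 / 2 * x) + Real.exp (-(1 / 2) * x)) := by
  have h1 := Real.pow_div_factorial_le_exp (|x| / 2) (by positivity) (2 * k)
  rw [div_le_iff₀ (by positivity), div_pow, Even.pow_abs (even_two_mul k),
    div_le_iff₀ (by positivity)] at h1
  have h2 : Real.exp (|x| / 2) ≤ Real.exp (1 / 2 * x) + Real.exp (-(1 / 2) * x) := by
    rcases abs_cases x with ⟨h, _⟩ | ⟨h, _⟩ <;> rw [h]
    · rw [show x / 2 = 1 / 2 * x by ring]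
      linarith [Real.exp_pos (-(1 / 2) * x)]
    · rw [show -x / 2 = -(1 / 2) * x by ring]
      linarith [Real.exp_pos (1 / 2 * x)]
  calc x ^ (2 * k) ≤ 2 ^ (2 * k) * (2 * k).factorial * Real.exp (|x| / 2) := by linarith
    _ ≤ _ := by gcongr

lemma allMoments_eval {n : ℕ} (i : Fin n) : AllMoments (laplaceVec n) fun x => x i := by
  refine ⟨measurable_pi_apply i, fun k => ?_⟩
  have h1 := (integrable_exp_mul_laplace_and (s := 1 / 2) (by norm_num [abs_of_pos])).1
  have h2 := (integrable_exp_mul_laplace_and (s := -(1 / 2))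
    (by rw [abs_neg]; norm_num [abs_of_pos])).1
  have h3 : Integrable (fun x : ℝ => x ^ (2 * k)) laplace := by
    refine Integrable.mono' ((h1.add h2).const_mul (2 ^ (2 * k) * (2 * k).factorial))
      (by fun_prop) (Filter.Eventually.of_forall fun x => ?_)
    rw [Real.norm_eq_abs, abs_of_nonneg ((even_two_mul k).pow_nonneg _)]
    exact even_pow_le_exp_add_exp k x
  exact integrable_comp_eval (μ := fun _ : Fin n => laplace) (f := fun y : ℝ => y ^ (2 * k)) h3

lemma AllMoments.comp_fst {n : ℕ} {f : (Fin n → ℝ) → ℝ} (hf : AllMoments (laplaceVec n) f) :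
    AllMoments (laplacePair n) fun v => f v.1 :=
  ⟨hf.1.comp measurable_fst, fun k => (hf.2 k).comp_fst _⟩

lemma AllMoments.comp_snd {n : ℕ} {f : (Fin n → ℝ) → ℝ} (hf : AllMoments (laplaceVec n) f) :
    AllMoments (laplacePair n) fun v => f v.2 :=
  ⟨hf.1.comp measurable_snd, fun k => (hf.2 k).comp_snd _⟩

/-! ### Fourth moments of linear and bilinear forms -/

/-- The transform factors into terms `1/(1 - c²) ≤ 1 + 2c² ≤ exp(2c²)`, valid for `c² ≤ 1/4`; the
product is at most `exp(1/2) ≤ 2`. -/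
lemma exp_linear_laplaceVec {n : ℕ} (c : Fin n → ℝ) (hc : ∑ i, c i ^ 2 ≤ 1 / 4) :
    Integrable (fun x => Real.exp (∑ i, c i * x i)) (laplaceVec n) ∧
      ∫ x, Real.exp (∑ i, c i * x i) ∂laplaceVec n ≤ 2 := by
  have hci (i : Fin n) : c i ^ 2 ≤ 1 / 4 :=
    (Finset.single_le_sum (f := fun i => c i ^ 2) (fun i _ => sq_nonneg _)
      (Finset.mem_univ i)).trans hc
  have habs (i : Fin n) : |c i| < 1 := by
    rw [← sq_lt_one_iff_abs_lt_one]; linarith [hci i]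
  simp only [Real.exp_sum]
  refine ⟨Integrable.fintype_prod (μ := fun _ : Fin n => laplace)
    (f := fun i y => Real.exp (c i * y)) fun i => (integrable_exp_mul_laplace_and (habs i)).1, ?_⟩
  rw [laplaceVec, integral_fintype_prod_eq_prod (μ := fun _ : Fin n => laplace)
    (fun i y => Real.exp (c i * y))]
  calc ∏ i, ∫ x, Real.exp (c i * x) ∂laplace
      ≤ ∏ i, Real.exp (2 * c i ^ 2) := by
        refine Finset.prod_le_prod (fun i _ => integral_nonneg fun x => (Real.exp_pos _).le)
          fun i _ => ?_
        rw [(integrable_exp_mul_laplace_and (habs i)).2]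
        have h1 := Real.add_one_le_exp (2 * c i ^ 2)
        refine le_trans ?_ h1
        rw [div_le_iff₀ (by linarith [hci i])]
        nlinarith [hci i, sq_nonneg (c i)]
    _ = Real.exp (2 * ∑ i, c i ^ 2) := by rw [← Real.exp_sum, Finset.mul_sum]
    _ ≤ Real.exp (1 / 2) := by gcongr; linarith
    _ ≤ 2 := by
        rw [← Real.le_log_iff_exp_le (by norm_num)]
        linarith [Real.log_two_gt_d9]

lemma allMoments_linear {n : ℕ} (c : Fin n → ℝ) :
    AllMoments (laplaceVec n) fun x => ∑ i, c i * x i :=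
  AllMoments.sum _ fun i _ => (allMoments_eval i).const_mul _

/-- The constant in the comparison of fourth and second moments. -/
@[irreducible] def momentConst : ℝ := 1536

lemma momentConst_pos : 0 < momentConst := by norm_num [momentConst]

lemma integral_linear_pow_four_le {n : ℕ} (c : Fin n → ℝ) :
    ∫ x, (∑ i, c i * x i) ^ 4 ∂laplaceVec n ≤ momentConst * (∑ i, c i ^ 2) ^ 2 := by
  rcases (Finset.sum_nonneg fun i (_ : i ∈ Finset.univ) => sq_nonneg (c i)).eq_or_lt with h0 | h0
  · have hc (i : Fin n) : c i = 0 := by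
      have := (Finset.sum_eq_zero_iff_of_nonneg fun i _ => sq_nonneg (c i)).1 h0.symm i
        (Finset.mem_univ i)
      simpa using this
    simp [hc]
  set σ := ∑ i, c i ^ 2 with hσ
  have hs : 0 < Real.sqrt σ := Real.sqrt_pos.2 h0
  have hs2 : Real.sqrt σ ^ 2 = σ := Real.sq_sqrt h0.le
  -- Dividing by `2√σ` makes the squared coefficients sum to exactly 1/4. Both signs are needed to
  -- dominate a fourth power; `2⁴ · 4! = 384`, times `2 + 2`, gives 1536.
  have hbound (ε : ℝ) (hε : ε ^ 2 = 1) := exp_linear_laplaceVec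
    (fun i => ε * (c i / (2 * Real.sqrt σ))) (by
      simp only [mul_pow, div_pow, hε, one_mul, hs2]
      rw [← Finset.sum_div, ← hσ]
      apply le_of_eq
      field_simp
      norm_num)
  obtain ⟨i1, b1⟩ := hbound 1 (by norm_num)
  obtain ⟨i2, b2⟩ := hbound (-1) (by norm_num)
  have hpt (x : Fin n → ℝ) : (∑ i, c i * x i) ^ 4 ≤ σ ^ 2 * 384 *
      (Real.exp (∑ i, 1 * (c i / (2 * Real.sqrt σ)) * x i)
        + Real.exp (∑ i, -1 * (c i / (2 * Real.sqrt σ)) * x i)) := by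
    have h := even_pow_le_exp_add_exp 2 ((∑ i, c i * x i) / Real.sqrt σ)
    have e1 : (1 : ℝ) / 2 * ((∑ i, c i * x i) / Real.sqrt σ)
        = ∑ i, 1 * (c i / (2 * Real.sqrt σ)) * x i := by
      rw [Finset.sum_div, Finset.mul_sum]
      refine Finset.sum_congr rfl fun i _ => ?_
      field_simp
    have e2 : -((1 : ℝ) / 2) * ((∑ i, c i * x i) / Real.sqrt σ)
        = ∑ i, -1 * (c i / (2 * Real.sqrt σ)) * x i := by
      rw [Finset.sum_div, Finset.mul_sum]
      refine Finset.sum_congr rfl fun i _ => ?_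
      field_simp
    rw [e1, e2] at h
    have e3 : ((∑ i, c i * x i) / Real.sqrt σ) ^ (2 * 2) = (∑ i, c i * x i) ^ 4 / σ ^ 2 := by
      rw [div_pow, pow_mul (Real.sqrt σ), hs2]
    rw [e3, div_le_iff₀ (by positivity)] at h
    refine h.trans (le_of_eq ?_)
    norm_num [Nat.factorial]
    ring
  calc ∫ x, (∑ i, c i * x i) ^ 4 ∂laplaceVec n
      ≤ ∫ x, σ ^ 2 * 384 * (Real.exp (∑ i, 1 * (c i / (2 * Real.sqrt σ)) * x i)
        + Real.exp (∑ i, -1 * (c i / (2 * Real.sqrt σ)) * x i)) ∂laplaceVec n :=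
        integral_mono ((allMoments_linear c).pow 4).integrable ((i1.add i2).const_mul _) hpt
    _ ≤ σ ^ 2 * 384 * (2 + 2) := by
        rw [integral_const_mul, integral_add i1 i2]
        gcongr
    _ = momentConst * σ ^ 2 := by rw [momentConst]; ring

/-- Fourth moment of the Euclidean norm of a vector of linear forms. -/
lemma integral_sum_sq_sq_le {n : ℕ} {ι : Type*} [Fintype ι] (c : Fin n → ι → ℝ) :
    ∫ x, (∑ j, (∑ i, c i j * x i) ^ 2) ^ 2 ∂laplaceVec n
      ≤ momentConst * (∑ j, ∑ i, c i j ^ 2) ^ 2 := by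
  have hm (j : ι) := allMoments_linear fun i => c i j
  have hnn (j : ι) : 0 ≤ ∑ i, c i j ^ 2 := Finset.sum_nonneg fun i _ => sq_nonneg _
  -- Cauchy-Schwarz weighted by the variances of the linear forms, so that the fourth moments are
  -- rescaled to be summable against those variances. A form of variance zero vanishes identically,
  -- which makes division by zero harmless.
  have hpt (x : Fin n → ℝ) : (∑ j, (∑ i, c i j * x i) ^ 2) ^ 2
      ≤ (∑ j, ∑ i, c i j ^ 2) * ∑ j, (∑ i, c i j * x i) ^ 4 / ∑ i, c i j ^ 2 := by
    refine Finset.sum_sq_le_sum_mul_sum_of_sq_le_mul _ (fun j _ => hnn j)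
      (fun j _ => div_nonneg (by positivity) (hnn j)) fun j _ => le_of_eq ?_
    rcases (hnn j).eq_or_lt with h0 | h0
    · have hc (i : Fin n) : c i j = 0 := by
        have := (Finset.sum_eq_zero_iff_of_nonneg fun i _ => sq_nonneg (c i j)).1 h0.symm i
          (Finset.mem_univ i)
        simpa using this
      simp [hc]
    · field_simp
  calc ∫ x, (∑ j, (∑ i, c i j * x i) ^ 2) ^ 2 ∂laplaceVec n
      ≤ ∫ x, (∑ j, ∑ i, c i j ^ 2) * ∑ j, (∑ i, c i j * x i) ^ 4 / ∑ i, c i j ^ 2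
          ∂laplaceVec n :=
        integral_mono ((AllMoments.sum _ fun j _ => (hm j).pow 2).pow 2).integrable
          ((AllMoments.sum _ fun j _ => ((hm j).pow 4).div_const _).const_mul _).integrable hpt
    _ = (∑ j, ∑ i, c i j ^ 2)
          * ∑ j, (∫ x, (∑ i, c i j * x i) ^ 4 ∂laplaceVec n) / ∑ i, c i j ^ 2 := by
        rw [integral_const_mul, integral_finsetSum _ fun j _ =>
          (((hm j).pow 4).div_const _).integrable]
        simp only [integral_div]
    _ ≤ (∑ j, ∑ i, c i j ^ 2) * ∑ j, momentConst * ∑ i, c i j ^ 2 := by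
        refine mul_le_mul_of_nonneg_left (Finset.sum_le_sum fun j _ => ?_)
          (Finset.sum_nonneg fun j _ => hnn j)
        refine div_le_of_le_mul₀ (hnn j) (mul_nonneg momentConst_pos.le (hnn j)) ?_
        refine (integral_linear_pow_four_le _).trans (le_of_eq ?_)
        ring
    _ = momentConst * (∑ j, ∑ i, c i j ^ 2) ^ 2 := by rw [← Finset.mul_sum]; ring

/-! ### Weighted fourth powers attached to a three-dimensional array -/

section Tensor

variable {n : ℕ} (a : Fin n → Fin n → Fin n → ℝ)

/-- The squared Hilbert-Schmidt norm of the `k`-th slice. -/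
noncomputable def sliceNorm (k : Fin n) : ℝ := ∑ i, ∑ j, a i j k ^ 2

/-- The array with the first two indices exchanged. -/
def swapArray : Fin n → Fin n → Fin n → ℝ := fun i j k => a j i k

/-- The vector valued bilinear form defined by the array. -/
noncomputable def bilin (v : (Fin n → ℝ) × (Fin n → ℝ)) (k : Fin n) : ℝ :=
  ∑ i, ∑ j, a i j k * v.1 i * v.2 j

/-- Fourth power of a weighted `ℓ⁴` norm. -/
noncomputable def quartic (r : Fin n → ℝ) : ℝ := ∑ k, r k ^ 4 / sliceNorm a k

/-- Fourth power of the weighted mixed `ℓ⁴(ℓ²)` norm of the matrix obtained by contracting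
the first index with `x`. -/
noncomputable def rowQuartic (x : Fin n → ℝ) : ℝ :=
  ∑ k, (∑ j, (∑ i, a i j k * x i) ^ 2) ^ 2 / sliceNorm a k

lemma sliceNorm_nonneg (k : Fin n) : 0 ≤ sliceNorm a k :=
  Finset.sum_nonneg fun _ _ => Finset.sum_nonneg fun _ _ => sq_nonneg _

lemma sliceNorm_swapArray : sliceNorm (swapArray a) = sliceNorm a := by
  funext k; exact Finset.sum_comm

lemma eq_zero_of_sliceNorm_eq_zero {k : Fin n} (h : sliceNorm a k = 0) (i j : Fin n) :
    a i j k = 0 := by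
  have h1 := (Finset.sum_eq_zero_iff_of_nonneg fun i _ =>
    Finset.sum_nonneg fun j _ => sq_nonneg (a i j k)).1 h i (Finset.mem_univ i)
  have h2 := (Finset.sum_eq_zero_iff_of_nonneg fun j _ => sq_nonneg (a i j k)).1 h1 j
    (Finset.mem_univ j)
  simpa using h2

lemma bilin_swapArray (v : (Fin n → ℝ) × (Fin n → ℝ)) :
    bilin (swapArray a) v.swap = bilin a v := by
  funext k
  rw [bilin, bilin, Finset.sum_comm]
  refine Finset.sum_congr rfl fun i _ => Finset.sum_congr rfl fun j _ => ?_
  simp only [swapArray, Prod.fst_swap, Prod.snd_swap]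
  ring

lemma bilin_eq_sum_fst (v : (Fin n → ℝ) × (Fin n → ℝ)) (k : Fin n) :
    bilin a v k = ∑ i, (∑ j, a i j k * v.2 j) * v.1 i := by
  refine Finset.sum_congr rfl fun i _ => ?_
  rw [Finset.sum_mul]
  exact Finset.sum_congr rfl fun j _ => by ring

lemma bilin_smul_add (t : ℝ) (v w : (Fin n → ℝ) × (Fin n → ℝ)) (k : Fin n) :
    bilin a (t • v + w) k = bilin a w k + t * bilin a (v.1, w.2) k + t * bilin a (w.1, v.2) k
      + t ^ 2 * bilin a v k := by
  simp only [bilin, Finset.mul_sum, ← Finset.sum_add_distrib]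
  refine Finset.sum_congr rfl fun i _ => Finset.sum_congr rfl fun j _ => ?_
  simp only [Prod.fst_add, Prod.snd_add, Prod.smul_fst, Prod.smul_snd, Pi.add_apply,
    Pi.smul_apply, smul_eq_mul]
  ring

lemma bilin_eq_zero_of_sliceNorm_eq_zero {k : Fin n} (h : sliceNorm a k = 0)
    (v : (Fin n → ℝ) × (Fin n → ℝ)) : bilin a v k = 0 := by
  simp [bilin, eq_zero_of_sliceNorm_eq_zero a h]

lemma quartic_nonneg (r : Fin n → ℝ) : 0 ≤ quartic a r :=
  Finset.sum_nonneg fun k _ => div_nonneg (by positivity) (sliceNorm_nonneg a k)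

lemma rowQuartic_nonneg (x : Fin n → ℝ) : 0 ≤ rowQuartic a x :=
  Finset.sum_nonneg fun k _ => div_nonneg (by positivity) (sliceNorm_nonneg a k)

lemma add_pow_four_le (u v : ℝ) : (u + v) ^ 4 ≤ 8 * (u ^ 4 + v ^ 4) := by
  have h1 : (u + v) ^ 2 ≤ 2 * (u ^ 2 + v ^ 2) := by nlinarith [sq_nonneg (u - v)]
  have h2 : ((u + v) ^ 2) ^ 2 ≤ (2 * (u ^ 2 + v ^ 2)) ^ 2 := by gcongr
  nlinarith [sq_nonneg (u ^ 2 - v ^ 2)]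

lemma quartic_sub_comm (r r' : Fin n → ℝ) : quartic a (r - r') = quartic a (r' - r) := by
  refine Finset.sum_congr rfl fun k _ => ?_
  simp only [Pi.sub_apply]
  rw [← neg_sub, Even.neg_pow (by decide)]

lemma quartic_add_le (r r' : Fin n → ℝ) :
    quartic a (r + r') ≤ 8 * (quartic a r + quartic a r') := by
  simp only [quartic]
  rw [← Finset.sum_add_distrib, Finset.mul_sum]
  refine Finset.sum_le_sum fun k _ => ?_
  rw [← add_div, mul_div_assoc']
  exact div_le_div_of_nonneg_right (add_pow_four_le _ _) (sliceNorm_nonneg a k)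

/-- The quasi-triangle inequality that converts a common point `r'` of two neighbourhoods into
closeness of their centres. -/
lemma quartic_sub_le (r r' r'' : Fin n → ℝ) :
    quartic a (r - r'') ≤ 8 * (quartic a (r' - r) + quartic a (r' - r'')) := by
  have := quartic_add_le a (r - r') (r' - r'')
  rwa [sub_add_sub_cancel, quartic_sub_comm a r r'] at this

lemma rowQuartic_neg (x : Fin n → ℝ) : rowQuartic a (-x) = rowQuartic a x := by
  simp [rowQuartic]

lemma rowQuartic_smul (t : ℝ) (x : Fin n → ℝ) :
    rowQuartic a (t • x) = t ^ 4 * rowQuartic a x := by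
  simp only [rowQuartic, Finset.mul_sum]
  refine Finset.sum_congr rfl fun k _ => ?_
  have h (j : Fin n) : (∑ i, a i j k * (t • x) i) ^ 2 = t ^ 2 * (∑ i, a i j k * x i) ^ 2 := by
    rw [← mul_pow, Finset.mul_sum]
    congr 1
    exact Finset.sum_congr rfl fun i _ => by simp only [Pi.smul_apply, smul_eq_mul]; ring
  simp only [h]
  rw [← Finset.mul_sum]
  ring

lemma rowQuartic_add_le (x x' : Fin n → ℝ) :
    rowQuartic a (x + x') ≤ 8 * (rowQuartic a x + rowQuartic a x') := by
  simp only [rowQuartic]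
  rw [← Finset.sum_add_distrib, Finset.mul_sum]
  refine Finset.sum_le_sum fun k _ => ?_
  rw [← add_div, mul_div_assoc']
  refine div_le_div_of_nonneg_right ?_ (sliceNorm_nonneg a k)
  set P := ∑ j, (∑ i, a i j k * x i) ^ 2
  set Q := ∑ j, (∑ i, a i j k * x' i) ^ 2
  have h0 : 0 ≤ ∑ j, (∑ i, a i j k * (x + x') i) ^ 2 := Finset.sum_nonneg fun j _ => sq_nonneg _
  have h : ∑ j, (∑ i, a i j k * (x + x') i) ^ 2 ≤ 2 * (P + Q) := by
    rw [← Finset.sum_add_distrib, Finset.mul_sum]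
    refine Finset.sum_le_sum fun j _ => ?_
    simp only [Pi.add_apply, mul_add, Finset.sum_add_distrib]
    nlinarith [sq_nonneg (∑ i, a i j k * x i - ∑ i, a i j k * x' i)]
  calc (∑ j, (∑ i, a i j k * (x + x') i) ^ 2) ^ 2 ≤ (2 * (P + Q)) ^ 2 := by gcongr
    _ ≤ 8 * (P ^ 2 + Q ^ 2) := by nlinarith [sq_nonneg (P - Q)]

lemma rowQuartic_sub_le (x x' x'' : Fin n → ℝ) :
    rowQuartic a (x - x'') ≤ 8 * (rowQuartic a (x' - x) + rowQuartic a (x' - x'')) := by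
  have := rowQuartic_add_le a (x - x') (x' - x'')
  rwa [sub_add_sub_cancel, ← rowQuartic_neg a (x - x'), neg_sub] at this

/-! ### Averages over the symmetric exponential law -/

lemma allMoments_rowQuartic : AllMoments (laplaceVec n) (rowQuartic a) :=
  AllMoments.sum _ fun k _ => ((AllMoments.sum _ fun j _ =>
    (allMoments_linear fun i => a i j k).pow 2).pow 2).div_const _

lemma allMoments_bilin (k : Fin n) : AllMoments (laplacePair n) fun v => bilin a v k :=
  AllMoments.sum _ fun i _ => AllMoments.sum _ fun j _ =>
    ((allMoments_eval i).comp_fst.const_mul (a i j k)).mul (allMoments_eval j).comp_snd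

lemma allMoments_bilin_fst (y : Fin n → ℝ) (k : Fin n) :
    AllMoments (laplaceVec n) fun x => bilin a (x, y) k := by
  simp only [bilin_eq_sum_fst]
  exact allMoments_linear _

lemma allMoments_bilin_snd (x : Fin n → ℝ) (k : Fin n) :
    AllMoments (laplaceVec n) fun y => bilin a (x, y) k := by
  have := allMoments_bilin_fst (swapArray a) x k
  simpa only [← bilin_swapArray a (x, _), Prod.swap_prod_mk] using this

lemma allMoments_bilin_smul_add (t : ℝ) (w : (Fin n → ℝ) × (Fin n → ℝ)) (k : Fin n) :
    AllMoments (laplacePair n) fun v => bilin a (t • v + w) k := by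
  simp only [bilin_smul_add]
  exact (((AllMoments.const _).add ((allMoments_bilin_fst a w.2 k).comp_fst.const_mul t)).add
    ((allMoments_bilin_snd a w.1 k).comp_snd.const_mul t)).add
    ((allMoments_bilin a k).const_mul (t ^ 2))

lemma AllMoments.quartic {Ω : Type*} [MeasurableSpace Ω] {ν : Measure Ω} [IsFiniteMeasure ν]
    {r : Ω → Fin n → ℝ} (hr : ∀ k, AllMoments ν fun ω => r ω k) :
    AllMoments ν fun ω => quartic a (r ω) :=
  AllMoments.sum _ fun k _ => ((hr k).pow 4).div_const _

/-- Each slice contributes a fourth moment of order `s_k²`, and the weight `1/s_k` leaves `s_k`, so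
the total is linear in the squared norm of the array. -/
lemma integral_rowQuartic_le :
    ∫ x, rowQuartic a x ∂laplaceVec n ≤ momentConst * ∑ k, sliceNorm a k := by
  have hm (k : Fin n) : AllMoments (laplaceVec n)
      fun x => (∑ j, (∑ i, a i j k * x i) ^ 2) ^ 2 :=
    (AllMoments.sum _ fun j _ => (allMoments_linear fun i => a i j k).pow 2).pow 2
  unfold rowQuartic
  rw [integral_finsetSum _ fun k _ => ((hm k).div_const _).integrable, Finset.mul_sum]
  refine Finset.sum_le_sum fun k _ => ?_
  rw [integral_div]
  refine div_le_of_le_mul₀ (sliceNorm_nonneg a k)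
    (mul_nonneg momentConst_pos.le (sliceNorm_nonneg a k)) ?_
  refine (integral_sum_sq_sq_le fun i j => a i j k).trans (le_of_eq ?_)
  rw [Finset.sum_comm, ← sliceNorm]
  ring

/-- With `y` frozen, each coordinate is a linear form in `x` whose squared coefficients sum to the
inner sum in `rowQuartic` of the swapped array. This is why the row and column semi-norms govern the
cross terms. -/
lemma integral_quartic_bilin_fst_le (y : Fin n → ℝ) :
    ∫ x, quartic a (bilin a (x, y)) ∂laplaceVec n
      ≤ momentConst * rowQuartic (swapArray a) y := by
  unfold quartic
  rw [integral_finsetSum _ fun k _ =>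
    (((allMoments_bilin_fst a y k).pow 4).div_const _).integrable, rowQuartic, Finset.mul_sum]
  refine Finset.sum_le_sum fun k _ => ?_
  rw [integral_div, sliceNorm_swapArray, mul_div_assoc']
  refine div_le_div_of_nonneg_right ?_ (sliceNorm_nonneg a k)
  simp only [bilin_eq_sum_fst]
  exact integral_linear_pow_four_le _

lemma quartic_swapArray (r : Fin n → ℝ) : quartic (swapArray a) r = quartic a r := by
  simp only [quartic, sliceNorm_swapArray]

lemma integral_quartic_bilin_snd_le (x : Fin n → ℝ) :
    ∫ y, quartic a (bilin a (x, y)) ∂laplaceVec n ≤ momentConst * rowQuartic a x := by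
  have : _ ≤ momentConst * rowQuartic a x := integral_quartic_bilin_fst_le (swapArray a) x
  simp only [quartic_swapArray] at this
  simpa only [← bilin_swapArray a (x, _), Prod.swap_prod_mk] using this

lemma integral_quartic_bilin_le :
    ∫ v, quartic a (bilin a v) ∂laplacePair n ≤ momentConst ^ 2 * ∑ k, sliceNorm a k := by
  have hint : Integrable (fun v => quartic a (bilin a v)) (laplacePair n) :=
    (AllMoments.quartic a fun k => allMoments_bilin a k).integrable
  rw [laplacePair, integral_prod _ hint]
  calc ∫ x, ∫ y, quartic a (bilin a (x, y)) ∂laplaceVec n ∂laplaceVec n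
      ≤ ∫ x, momentConst * rowQuartic a x ∂laplaceVec n :=
        integral_mono hint.integral_prod_left
          ((allMoments_rowQuartic a).integrable.const_mul _)
          fun x => integral_quartic_bilin_snd_le a x
    _ ≤ momentConst * (momentConst * ∑ k, sliceNorm a k) := by
        rw [integral_const_mul]
        exact mul_le_mul_of_nonneg_left (integral_rowQuartic_le a) momentConst_pos.le
    _ = _ := by ring

lemma integral_comp_fst_laplacePair (f : (Fin n → ℝ) → ℝ) :
    ∫ v, f v.1 ∂laplacePair n = ∫ x, f x ∂laplaceVec n := by
  rw [laplacePair, integral_fun_fst]; simp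

lemma integral_comp_snd_laplacePair (f : (Fin n → ℝ) → ℝ) :
    ∫ v, f v.2 ∂laplacePair n = ∫ x, f x ∂laplaceVec n := by
  rw [laplacePair, integral_fun_snd]; simp

lemma add_four_pow_four_le (u v x y : ℝ) :
    (u + v + x + y) ^ 4 ≤ 64 * (u ^ 4 + v ^ 4 + x ^ 4 + y ^ 4) := by
  have h1 := add_pow_four_le (u + v) (x + y)
  have h2 := add_pow_four_le u v
  have h3 := add_pow_four_le x y
  rw [add_assoc (u + v)]
  linarith

/-- The effect of smoothing on the weighted fourth power of a bilinear form. -/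
lemma integral_quartic_bilin_smul_add_sub_le (t : ℝ) (w : (Fin n → ℝ) × (Fin n → ℝ))
    (r : Fin n → ℝ) :
    ∫ v, quartic a (bilin a (t • v + w) - r) ∂laplacePair n
      ≤ 64 * (quartic a (bilin a w - r) + t ^ 4 * (momentConst * rowQuartic (swapArray a) w.2)
        + t ^ 4 * (momentConst * rowQuartic a w.1)
        + t ^ 8 * (momentConst ^ 2 * ∑ k, sliceNorm a k)) := by
  have i1 : Integrable (fun v : (Fin n → ℝ) × (Fin n → ℝ) => quartic a (bilin a (v.1, w.2)))
      (laplacePair n) :=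
    (AllMoments.quartic a fun k => (allMoments_bilin_fst a w.2 k).comp_fst).integrable
  have i2 : Integrable (fun v : (Fin n → ℝ) × (Fin n → ℝ) => quartic a (bilin a (w.1, v.2)))
      (laplacePair n) :=
    (AllMoments.quartic a fun k => (allMoments_bilin_snd a w.1 k).comp_snd).integrable
  have i3 : Integrable (fun v => quartic a (bilin a v)) (laplacePair n) :=
    (AllMoments.quartic a fun k => allMoments_bilin a k).integrable
  have i0 : Integrable (fun v => quartic a (bilin a (t • v + w) - r)) (laplacePair n) :=
    (AllMoments.quartic a fun k => (allMoments_bilin_smul_add a t w k).sub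
      (AllMoments.const (r k))).integrable
  -- Bilinear expansion into the centre, two cross terms and the pure noise term; applying the
  -- two-term inequality twice gives `64 = 8 · 8`.
  have hpt (v : (Fin n → ℝ) × (Fin n → ℝ)) : quartic a (bilin a (t • v + w) - r)
      ≤ 64 * (quartic a (bilin a w - r) + t ^ 4 * quartic a (bilin a (v.1, w.2))
        + t ^ 4 * quartic a (bilin a (w.1, v.2)) + t ^ 8 * quartic a (bilin a v)) := by
    simp only [quartic, Finset.mul_sum, ← Finset.sum_add_distrib]
    refine Finset.sum_le_sum fun k _ => ?_
    simp only [Pi.sub_apply, bilin_smul_add]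
    rw [mul_div_assoc', mul_div_assoc', mul_div_assoc', ← add_div, ← add_div, ← add_div,
      mul_div_assoc']
    refine div_le_div_of_nonneg_right ?_ (sliceNorm_nonneg a k)
    have h := add_four_pow_four_le (bilin a w k - r k) (t * bilin a (v.1, w.2) k)
      (t * bilin a (w.1, v.2) k) (t ^ 2 * bilin a v k)
    calc _ = (bilin a w k - r k + t * bilin a (v.1, w.2) k + t * bilin a (w.1, v.2) k
          + t ^ 2 * bilin a v k) ^ 4 := by ring
      _ ≤ _ := h
      _ = _ := by ring
  calc ∫ v, quartic a (bilin a (t • v + w) - r) ∂laplacePair n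
      ≤ ∫ v, 64 * (quartic a (bilin a w - r) + t ^ 4 * quartic a (bilin a (v.1, w.2))
        + t ^ 4 * quartic a (bilin a (w.1, v.2)) + t ^ 8 * quartic a (bilin a v))
          ∂laplacePair n :=
        integral_mono i0 (((((integrable_const _).add (i1.const_mul _)).add
          (i2.const_mul _)).add (i3.const_mul _)).const_mul _) hpt
    _ = 64 * (quartic a (bilin a w - r)
        + t ^ 4 * ∫ x, quartic a (bilin a (x, w.2)) ∂laplaceVec n
        + t ^ 4 * ∫ y, quartic a (bilin a (w.1, y)) ∂laplaceVec n
        + t ^ 8 * ∫ v, quartic a (bilin a v) ∂laplacePair n) := by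
        have j1 : Integrable (fun v : (Fin n → ℝ) × (Fin n → ℝ) => quartic a (bilin a w - r)
            + t ^ 4 * quartic a (bilin a (v.1, w.2))) (laplacePair n) :=
          (integrable_const _).add (i1.const_mul _)
        have j2 : Integrable (fun v : (Fin n → ℝ) × (Fin n → ℝ) => quartic a (bilin a w - r)
            + t ^ 4 * quartic a (bilin a (v.1, w.2))
            + t ^ 4 * quartic a (bilin a (w.1, v.2))) (laplacePair n) :=
          j1.add (i2.const_mul _)
        rw [integral_const_mul, integral_add j2 (i3.const_mul _),
          integral_add j1 (i2.const_mul _), integral_add (integrable_const _) (i1.const_mul _), integral_const_mul,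
          integral_const_mul, integral_const_mul,
          integral_comp_fst_laplacePair (fun x => quartic a (bilin a (x, w.2))),
          integral_comp_snd_laplacePair (fun y => quartic a (bilin a (w.1, y)))]
        simp
    _ ≤ _ := by
        gcongr
        · exact integral_quartic_bilin_fst_le a w.2
        · exact integral_quartic_bilin_snd_le a w.1
        · exact integral_quartic_bilin_le a

/-- Smoothing does not change the mean of a bilinear form. -/
lemma integral_bilin_smul_add (t : ℝ) (w : (Fin n → ℝ) × (Fin n → ℝ)) (k : Fin n) :
    ∫ v, bilin a (t • v + w) k ∂laplacePair n = bilin a w k := by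
  have n1 : MeasurePreserving (fun v : (Fin n → ℝ) × (Fin n → ℝ) => (-v.1, v.2))
      (laplacePair n) (laplacePair n) :=
    (measurePreserving_neg_laplaceVec n).prod (MeasurePreserving.id _)
  have n2 : MeasurePreserving (fun v : (Fin n → ℝ) × (Fin n → ℝ) => (v.1, -v.2))
      (laplacePair n) (laplacePair n) :=
    (MeasurePreserving.id _).prod (measurePreserving_neg_laplaceVec n)
  -- Every nonconstant term of the expansion is odd under negation of one of the two Laplace
  -- vectors, a symmetry of the law.
  have odd {f : (Fin n → ℝ) × (Fin n → ℝ) → ℝ} (hf : AllMoments (laplacePair n) f)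
      {σ : (Fin n → ℝ) × (Fin n → ℝ) → (Fin n → ℝ) × (Fin n → ℝ)}
      (hσ : MeasurePreserving σ (laplacePair n) (laplacePair n))
      (h : ∀ v, f (σ v) = - f v) : ∫ v, f v ∂laplacePair n = 0 := by
    have h1 : ∫ v, f v ∂laplacePair n = ∫ v, f (σ v) ∂laplacePair n := by
      conv_lhs => rw [← hσ.map_eq]
      exact integral_map hσ.measurable.aemeasurable hf.1.aestronglyMeasurable
    simp only [h, integral_neg] at h1
    linarith
  have m1 := (allMoments_bilin_fst a w.2 k).comp_fst
  have m2 := (allMoments_bilin_snd a w.1 k).comp_snd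
  have m3 := allMoments_bilin a k
  have z1 := odd m1 n1 fun v => by simp [bilin]
  have z2 := odd m2 n2 fun v => by simp [bilin]
  have z3 := odd m3 n1 fun v => by simp [bilin]
  simp only [bilin_smul_add]
  rw [integral_add (((AllMoments.const _).add (m1.const_mul t)).add (m2.const_mul t)).integrable
      (m3.const_mul (t ^ 2)).integrable, integral_add ((AllMoments.const _).add
      (m1.const_mul t)).integrable (m2.const_mul t).integrable,
    integral_add (integrable_const _) (m1.const_mul t).integrable, integral_const_mul,
    integral_const_mul, integral_const_mul, z1, z2, z3]
  simp

end Tensor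

/-! ### Finite nets from lower bounds on the measure of neighbourhoods -/

/-- Markov's inequality at level `2M`; when `M = 0` it says nothing, but then the function vanishes
almost everywhere. -/
lemma half_le_measureReal_le_two_mul {Ω : Type*} [MeasurableSpace Ω] {ν : Measure Ω}
    [IsProbabilityMeasure ν] {f : Ω → ℝ} (hf : Measurable f) (h0 : ∀ ω, 0 ≤ f ω)
    (hi : Integrable f ν) {M : ℝ} (hM : ∫ ω, f ω ∂ν ≤ M) :
    1 / 2 ≤ ν.real {ω | f ω ≤ 2 * M} := by
  rcases ((integral_nonneg h0).trans hM).eq_or_lt with h | h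
  · have hz : ∫ ω, f ω ∂ν = 0 := le_antisymm (h ▸ hM) (integral_nonneg h0)
    have hae := (integral_eq_zero_iff_of_nonneg h0 hi).1 hz
    have : ν {ω | f ω ≤ 2 * M} = 1 := by
      rw [prob_compl_eq_zero_iff (measurableSet_le hf measurable_const) |>.symm]
      refine measure_mono_null ?_ (ae_iff.1 hae)
      intro ω hω
      simp only [Set.mem_compl_iff, Set.mem_ofPred_eq, not_le] at hω
      simp only [Set.mem_ofPred_eq, Pi.zero_apply]
      linarith
    rw [measureReal_def, this]
    norm_num
  · have h1 := mul_meas_ge_le_integral_of_nonneg (Filter.Eventually.of_forall h0) hi (2 * M)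
    have h2 : ν.real {ω | 2 * M ≤ f ω} ≤ 1 / 2 := by
      have : 2 * M * ν.real {ω | 2 * M ≤ f ω} ≤ M := h1.trans hM
      nlinarith
    have h3 : ν.real {ω | f ω ≤ 2 * M}ᶜ ≤ 1 / 2 := by
      refine (measureReal_mono fun ω hω => ?_).trans h2
      simp only [Set.mem_compl_iff, Set.mem_ofPred_eq, not_le] at hω
      exact hω.le
    rw [measureReal_compl (measurableSet_le hf measurable_const), probReal_univ] at h3
    linarith

/-- A packing argument: total mass one bounds the size of any family with disjoint neighbourhoods,
so a family of largest cardinality exists, and maximality forces every other neighbourhood to meet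
one of its members. -/
lemma exists_finset_net {Ω β : Type*} [MeasurableSpace Ω] (ν : Measure Ω)
    [IsProbabilityMeasure ν] (S : Set β) (U : β → Set Ω) (hU : ∀ w, MeasurableSet (U w))
    {κ : ℝ} (hκ : 0 < κ) (h : ∀ w ∈ S, κ ≤ ν.real (U w)) :
    ∃ F : Finset β, ↑F ⊆ S ∧ (F.card : ℝ) ≤ κ⁻¹ ∧ ∀ w ∈ S, ∃ c ∈ F, (U w ∩ U c).Nonempty := by
  classical
  have hcard (F : Finset β) (hF : ↑F ⊆ S) (hd : (F : Set β).PairwiseDisjoint U) :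
      (F.card : ℝ) ≤ κ⁻¹ := by
    rw [← one_div, le_div_iff₀ hκ]
    calc (F.card : ℝ) * κ = ∑ _w ∈ F, κ := by simp
      _ ≤ ∑ w ∈ F, ν.real (U w) := Finset.sum_le_sum fun w hw => h w (hF hw)
      _ = ν.real (⋃ w ∈ F, U w) := (measureReal_biUnion_finset hd fun w _ => hU w).symm
      _ ≤ 1 := measureReal_le_one
  let A : Set ℕ := {m | ∃ F : Finset β, ↑F ⊆ S ∧ (F : Set β).PairwiseDisjoint U ∧ F.card = m}
  have hne : A.Nonempty := ⟨0, ∅, by simp, by simp, rfl⟩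
  have hbdd : BddAbove A := by
    refine ⟨⌊κ⁻¹⌋₊, ?_⟩
    rintro m ⟨F, h1, h2, rfl⟩
    exact Nat.le_floor (hcard F h1 h2)
  obtain ⟨F, hFS, hFd, hFm⟩ := Nat.sSup_mem hne hbdd
  refine ⟨F, hFS, hcard F hFS hFd, fun w hw => ?_⟩
  by_contra! hcon
  have hwne : (U w).Nonempty := by
    by_contra hemp
    have := h w hw
    rw [Set.not_nonempty_iff_eq_empty.1 hemp, measureReal_empty] at this
    linarith
  have hwF : w ∉ F := fun hwF => by
    have := hcon w hwF
    rw [Set.inter_self] at this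
    exact hwne.ne_empty this
  have hmem : F.card + 1 ∈ A := by
    refine ⟨insert w F, ?_, ?_, Finset.card_insert_of_notMem hwF⟩
    · rw [Finset.coe_insert]
      exact Set.insert_subset hw hFS
    · rw [Finset.coe_insert]
      refine hFd.insert fun c hc _ => ?_
      exact Set.disjoint_iff_inter_eq_empty.2 (hcon c hc)
  have := le_csSup hbdd hmem
  omega

/-- If a translate of a set has measure at least one half, then the set itself is not too
small. -/
lemma exp_le_measureReal_of_half_le {n : ℕ} (s : (Fin n → ℝ) × (Fin n → ℝ)) {K : ℝ}
    (hK0 : 0 ≤ K) (hK : ∫ v, pairCost s v ∂laplacePair n ≤ K)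
    {U : Set ((Fin n → ℝ) × (Fin n → ℝ))} (hU : MeasurableSet U)
    (h : 1 / 2 ≤ (laplacePair n).real {v | v + s ∈ U}) :
    Real.exp (-(2 * K + 2)) ≤ (laplacePair n).real U := by
  have hUs : MeasurableSet {v : (Fin n → ℝ) × (Fin n → ℝ) | v + s ∈ U} :=
    (measurable_id.add_const s) hU
  have hind (v : (Fin n → ℝ) × (Fin n → ℝ)) : U.indicator (fun _ => 2 * K + 2) (v + s)
      = Set.indicator {v | v + s ∈ U} (fun _ => 2 * K + 2) v := rfl
  -- The height `2K + 2` is chosen so that half of it, minus the cost `K`, leaves at least 1. The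
  -- exponential is then at least 2, while the right side is at most `1 + exp(2K+2)` times the mass
  -- of `U`.
  have key := exp_integral_sub_integral_pairCost_le s (U.indicator fun _ => 2 * K + 2)
    (measurable_const.indicator hU) (by
      simp only [hind]
      exact (integrable_const _).indicator hUs)
  have h1 : 1 ≤ ∫ v, U.indicator (fun _ => 2 * K + 2) (v + s) ∂laplacePair n
      - ∫ v, pairCost s v ∂laplacePair n := by
    simp only [hind]
    rw [integral_indicator_const _ hUs, smul_eq_mul]
    nlinarith
  have h2 : ∫⁻ v, ENNReal.ofReal (Real.exp (U.indicator (fun _ => 2 * K + 2) v)) ∂laplacePair n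
      ≤ ENNReal.ofReal (1 + Real.exp (2 * K + 2) * (laplacePair n).real U) := by
    calc _ ≤ ∫⁻ v, ENNReal.ofReal (1 + U.indicator (fun _ => Real.exp (2 * K + 2)) v)
          ∂laplacePair n := by
          refine lintegral_mono fun v => ENNReal.ofReal_le_ofReal ?_
          by_cases hv : v ∈ U
          · simp [hv]
          · simp [hv]
      _ = _ := by
          have hi := (integrable_const (μ := laplacePair n) (Real.exp (2 * K + 2))).indicator hU
          have hi' : Integrable (fun v => 1 + U.indicator (fun _ => Real.exp (2 * K + 2)) v)
              (laplacePair n) := (integrable_const _).add hi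
          rw [← ofReal_integral_eq_lintegral_ofReal hi'
            (Filter.Eventually.of_forall fun v => add_nonneg zero_le_one
              (Set.indicator_nonneg (fun _ _ => (Real.exp_pos _).le) v)),
            integral_add (integrable_const _) hi, integral_indicator_const _ hU]
          simp [mul_comm]
  have h3 := (ENNReal.ofReal_le_ofReal_iff (add_nonneg zero_le_one
    (mul_nonneg (Real.exp_pos _).le measureReal_nonneg))).1 (key.trans h2)
  have h4 : 2 ≤ Real.exp (∫ v, U.indicator (fun _ => 2 * K + 2) (v + s) ∂laplacePair n
      - ∫ v, pairCost s v ∂laplacePair n) := by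
    linarith [Real.add_one_le_exp (∫ v, U.indicator (fun _ => 2 * K + 2) (v + s) ∂laplacePair n
      - ∫ v, pairCost s v ∂laplacePair n)]
  rw [Real.exp_neg, inv_le_iff_one_le_mul₀ (Real.exp_pos _), mul_comm]
  linarith

/-- A set containing all differences of points of `mixedBall n p`. -/
def enlargedBall (n : ℕ) (p : ℝ) : Set (Fin n → ℝ) :=
  {x | ∃ u v : Fin n → ℝ, x = u + v ∧ ∑ i, u i ^ 2 ≤ 4 ∧ ∑ i, |v i| ≤ 2 * Real.sqrt p}

lemma exists_add_of_mem_mixedBall {n : ℕ} {p : ℝ} {x : Fin n → ℝ} (hx : x ∈ mixedBall n p) :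
    ∃ u v : Fin n → ℝ, x = u + v ∧ ∑ i, u i ^ 2 ≤ 1 ∧ ∑ i, |v i| ≤ Real.sqrt p := by
  obtain ⟨u, hu, v', ⟨v, hv, rfl⟩, rfl⟩ := Set.mem_add.1 hx
  refine ⟨u, Real.sqrt p • v, rfl, hu, ?_⟩
  simp only [Pi.smul_apply, smul_eq_mul, abs_mul, ← Finset.mul_sum]
  rw [abs_of_nonneg (Real.sqrt_nonneg p)]
  exact mul_le_of_le_one_right (Real.sqrt_nonneg p) hv

lemma mixedBall_subset_enlargedBall (n : ℕ) (p : ℝ) : mixedBall n p ⊆ enlargedBall n p := by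
  intro x hx
  obtain ⟨u, v, h, hu, hv⟩ := exists_add_of_mem_mixedBall hx
  exact ⟨u, v, h, by linarith, by linarith [Real.sqrt_nonneg p]⟩

lemma sub_mem_enlargedBall {n : ℕ} {p : ℝ} {x y : Fin n → ℝ} (hx : x ∈ mixedBall n p)
    (hy : y ∈ mixedBall n p) : x - y ∈ enlargedBall n p := by
  obtain ⟨u, v, rfl, hu, hv⟩ := exists_add_of_mem_mixedBall hx
  obtain ⟨u', v', rfl, hu', hv'⟩ := exists_add_of_mem_mixedBall hy
  refine ⟨u - u', v - v', by abel, ?_, ?_⟩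
  · calc ∑ i, (u - u') i ^ 2 ≤ ∑ i, (2 * u i ^ 2 + 2 * u' i ^ 2) := by
          refine Finset.sum_le_sum fun i _ => ?_
          simp only [Pi.sub_apply]
          nlinarith [sq_nonneg (u i + u' i)]
      _ ≤ 4 := by
          rw [Finset.sum_add_distrib, ← Finset.mul_sum, ← Finset.mul_sum]
          linarith
  · calc ∑ i, |(v - v') i| ≤ ∑ i, (|v i| + |v' i|) :=
          Finset.sum_le_sum fun i _ => abs_sub _ _
      _ ≤ 2 * Real.sqrt p := by
          rw [Finset.sum_add_distrib]
          linarith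

lemma integral_shiftCost_sqrt_smul_le {n : ℕ} {p : ℝ} (hp : 0 ≤ p) {x : Fin n → ℝ}
    (hx : x ∈ enlargedBall n p) :
    ∫ y, shiftCost (Real.sqrt p • x) y ∂laplaceVec n ≤ 6 * p := by
  obtain ⟨u, v, rfl, hu, hv⟩ := hx
  rw [smul_add]
  refine (integral_shiftCost_le _ _).trans ?_
  simp only [Pi.smul_apply, smul_eq_mul, mul_pow, abs_mul, ← Finset.mul_sum]
  rw [abs_of_nonneg (Real.sqrt_nonneg p), Real.sq_sqrt hp]
  have h1 : Real.sqrt p * ∑ i, |v i| ≤ Real.sqrt p * (2 * Real.sqrt p) :=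
    mul_le_mul_of_nonneg_left hv (Real.sqrt_nonneg p)
  nlinarith [Real.mul_self_sqrt hp]

lemma integral_pairCost_sqrt_smul_le {n : ℕ} {p : ℝ} (hp : 0 ≤ p)
    {w : (Fin n → ℝ) × (Fin n → ℝ)} (hw : w ∈ enlargedBall n p ×ˢ enlargedBall n p) :
    ∫ v, pairCost (Real.sqrt p • w) v ∂laplacePair n ≤ 12 * p := by
  simp only [pairCost]
  rw [integral_add]
  · rw [integral_comp_fst_laplacePair (shiftCost (Real.sqrt p • w).1),
      integral_comp_snd_laplacePair (shiftCost (Real.sqrt p • w).2)]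
    have h1 := integral_shiftCost_sqrt_smul_le hp hw.1
    have h2 := integral_shiftCost_sqrt_smul_le hp hw.2
    simp only [Prod.smul_fst, Prod.smul_snd]
    linarith
  · exact (integrable_shiftCost _).comp_fst _
  · exact (integrable_shiftCost _).comp_snd _

lemma inv_sqrt_smul_add_sqrt_smul {n : ℕ} {p : ℝ} (hp : 0 < p)
    (v w : (Fin n → ℝ) × (Fin n → ℝ)) :
    (Real.sqrt p)⁻¹ • (v + Real.sqrt p • w) = (Real.sqrt p)⁻¹ • v + w := by
  rw [smul_add, smul_smul, inv_mul_cancel₀ (Real.sqrt_pos.2 hp).ne', one_smul]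

/-- Nets with respect to a "distance" whose smoothed averages are bounded. -/
lemma exists_finset_net_of_integral_le {n : ℕ} {p : ℝ} (hp : 1 ≤ p)
    (W : Set ((Fin n → ℝ) × (Fin n → ℝ))) (hW : W ⊆ enlargedBall n p ×ˢ enlargedBall n p)
    (f : (Fin n → ℝ) × (Fin n → ℝ) → (Fin n → ℝ) × (Fin n → ℝ) → ℝ)
    (hf : ∀ w, Measurable (f w)) (h0 : ∀ w v, 0 ≤ f w v) {M : ℝ}
    (hi : ∀ w ∈ W, Integrable (fun v => f w ((Real.sqrt p)⁻¹ • v + w)) (laplacePair n))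
    (hM : ∀ w ∈ W, ∫ v, f w ((Real.sqrt p)⁻¹ • v + w) ∂laplacePair n ≤ M) :
    ∃ F : Finset ((Fin n → ℝ) × (Fin n → ℝ)), ↑F ⊆ W ∧ (F.card : ℝ) ≤ Real.exp (26 * p) ∧
      ∀ w ∈ W, ∃ c ∈ F, ∃ v, f w v ≤ 2 * M ∧ f c v ≤ 2 * M := by
  have hU (w : (Fin n → ℝ) × (Fin n → ℝ)) :
      MeasurableSet {v | f w ((Real.sqrt p)⁻¹ • v) ≤ 2 * M} :=
    measurableSet_le ((hf w).comp (measurable_const_smul _)) measurable_const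
  obtain ⟨F, hFW, hFc, hF⟩ := exists_finset_net (laplacePair n) W
    (fun w => {v | f w ((Real.sqrt p)⁻¹ • v) ≤ 2 * M}) hU
    -- The entropy cost is `K = 12p`, and `2K + 2 ≤ 26p` because `p ≥ 1`.
    (Real.exp_pos (-(2 * (12 * p) + 2))) fun w hw => by
      refine exp_le_measureReal_of_half_le (Real.sqrt p • w) (by linarith)
        (integral_pairCost_sqrt_smul_le (by linarith) (hW hw)) (hU w) ?_
      simp only [Set.mem_ofPred_eq, inv_sqrt_smul_add_sqrt_smul (by linarith : 0 < p)]
      exact half_le_measureReal_le_two_mul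
        ((hf w).comp ((measurable_const_smul _).add_const w)) (fun v => h0 w _) (hi w hw) (hM w hw)
  refine ⟨F, hFW, hFc.trans ?_, fun w hw => ?_⟩
  · rw [← Real.exp_neg]
    exact Real.exp_le_exp.2 (by linarith)
  · obtain ⟨c, hc, v, hv1, hv2⟩ := hF w hw
    exact ⟨c, hc, (Real.sqrt p)⁻¹ • v, hv1, hv2⟩

section Nets

variable {n : ℕ} (a : Fin n → Fin n → Fin n → ℝ)

@[fun_prop]
lemma measurable_rowQuartic : Measurable (rowQuartic a) := (allMoments_rowQuartic a).1

@[fun_prop]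
lemma measurable_bilin : Measurable (bilin a) := by
  unfold bilin; fun_prop

@[fun_prop]
lemma measurable_quartic : Measurable (quartic a) := by
  unfold quartic; fun_prop

lemma inv_sqrt_pow_four {p : ℝ} (hp : 0 ≤ p) : (Real.sqrt p)⁻¹ ^ 4 = 1 / p ^ 2 := by
  rw [inv_pow, show (4 : ℕ) = 2 * 2 from rfl, pow_mul, Real.sq_sqrt hp, one_div]

lemma inv_sqrt_pow_eight {p : ℝ} (hp : 0 ≤ p) : (Real.sqrt p)⁻¹ ^ 8 = 1 / p ^ 4 := by
  rw [inv_pow, show (8 : ℕ) = 2 * 4 from rfl, pow_mul, Real.sq_sqrt hp, one_div]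

/-- The radius, in the row and column semi-norms, of the cells of the first partition. -/
@[irreducible] noncomputable def firstRadius (p : ℝ) : ℝ := 64 * (momentConst * (∑ k, sliceNorm a k) / p ^ 2)

/-- The radius, in the bilinear semi-norm, of the cells of the second partition. -/
@[irreducible] noncomputable def secondRadius (p : ℝ) : ℝ :=
  10 ^ 6 * (momentConst ^ 2 * (∑ k, sliceNorm a k) / p ^ 4)

/-- The row and column quantities are added so that one net serves both. Scaling by `1/√p` divides
fourth powers by `p²`. The neighbourhood level is `4 momentConst A / p²`, and two neighbourhoods
through the factor 8 give the 64 in `firstRadius`. -/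
lemma exists_first_net {p : ℝ} (hp : 1 ≤ p) (W : Set ((Fin n → ℝ) × (Fin n → ℝ)))
    (hW : W ⊆ enlargedBall n p ×ˢ enlargedBall n p) :
    ∃ F : Finset ((Fin n → ℝ) × (Fin n → ℝ)), ↑F ⊆ W ∧ (F.card : ℝ) ≤ Real.exp (26 * p) ∧
      ∀ w ∈ W, ∃ c ∈ F, rowQuartic a (w - c).1 ≤ firstRadius a p ∧
        rowQuartic (swapArray a) (w - c).2 ≤ firstRadius a p := by
  have i1 : Integrable (fun v : (Fin n → ℝ) × (Fin n → ℝ) => rowQuartic a v.1) (laplacePair n) :=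
    (allMoments_rowQuartic a).comp_fst.integrable
  have i2 : Integrable (fun v : (Fin n → ℝ) × (Fin n → ℝ) => rowQuartic (swapArray a) v.2)
      (laplacePair n) := (allMoments_rowQuartic (swapArray a)).comp_snd.integrable
  have heq (w v : (Fin n → ℝ) × (Fin n → ℝ)) :
      rowQuartic a (((Real.sqrt p)⁻¹ • v + w) - w).1
        + rowQuartic (swapArray a) (((Real.sqrt p)⁻¹ • v + w) - w).2
      = 1 / p ^ 2 * (rowQuartic a v.1 + rowQuartic (swapArray a) v.2) := by
    rw [add_sub_cancel_right, Prod.smul_fst, Prod.smul_snd, rowQuartic_smul, rowQuartic_smul,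
      inv_sqrt_pow_four (by linarith)]
    ring
  obtain ⟨F, hFW, hFc, hF⟩ := exists_finset_net_of_integral_le hp W hW
    (fun w v => rowQuartic a (v - w).1 + rowQuartic (swapArray a) (v - w).2)
    (fun w => by fun_prop)
    (fun w v => add_nonneg (rowQuartic_nonneg _ _) (rowQuartic_nonneg _ _))
    (M := 2 * (momentConst * (∑ k, sliceNorm a k) / p ^ 2))
    (fun w _ => by
      simp only [heq]
      exact (i1.add i2).const_mul _)
    (fun w _ => by
      simp only [heq]
      rw [integral_const_mul, integral_add i1 i2, integral_comp_fst_laplacePair (rowQuartic a),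
        integral_comp_snd_laplacePair (rowQuartic (swapArray a))]
      have h1 := integral_rowQuartic_le a
      have h2 := integral_rowQuartic_le (swapArray a)
      rw [sliceNorm_swapArray] at h2
      calc _ ≤ 1 / p ^ 2 * (momentConst * (∑ k, sliceNorm a k)
            + momentConst * (∑ k, sliceNorm a k)) := by gcongr
        _ = _ := by ring)
  refine ⟨F, hFW, hFc, fun w hw => ?_⟩
  obtain ⟨c, hc, v, h1, h2⟩ := hF w hw
  have e1 := rowQuartic_sub_le a w.1 v.1 c.1
  have e2 := rowQuartic_sub_le (swapArray a) w.2 v.2 c.2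
  have p1 := rowQuartic_nonneg a (v - w).1
  have p2 := rowQuartic_nonneg a (v - c).1
  have p3 := rowQuartic_nonneg (swapArray a) (v - w).2
  have p4 := rowQuartic_nonneg (swapArray a) (v - c).2
  simp only [Prod.fst_sub, Prod.snd_sub] at *
  refine ⟨c, hc, ?_, ?_⟩ <;> rw [firstRadius] <;> linarith

/-- The payoff of recentring: the cross terms gain `1/p²` from the smoothing scale and `1/p²` from
`firstRadius`, matching the pure noise term. The constant is `64 · (64 + 64 + 1) = 8256`. -/
lemma integral_quartic_smoothing_le {p : ℝ} (hp : 1 ≤ p) {w : (Fin n → ℝ) × (Fin n → ℝ)}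
    (h1 : rowQuartic a w.1 ≤ firstRadius a p)
    (h2 : rowQuartic (swapArray a) w.2 ≤ firstRadius a p) (r : Fin n → ℝ) :
    ∫ v, quartic a (bilin a ((Real.sqrt p)⁻¹ • v + w) - r) ∂laplacePair n
      ≤ 64 * quartic a (bilin a w - r)
        + 8256 * (momentConst ^ 2 * (∑ k, sliceNorm a k) / p ^ 4) := by
  refine (integral_quartic_bilin_smul_add_sub_le a _ w r).trans ?_
  rw [inv_sqrt_pow_four (by linarith), inv_sqrt_pow_eight (by linarith)]
  have hC := momentConst_pos
  calc _ ≤ 64 * (quartic a (bilin a w - r) + 1 / p ^ 2 * (momentConst * firstRadius a p)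
        + 1 / p ^ 2 * (momentConst * firstRadius a p)
        + 1 / p ^ 4 * (momentConst ^ 2 * ∑ k, sliceNorm a k)) := by gcongr
    _ = _ := by
        rw [firstRadius]
        field_simp
        ring

lemma integrable_quartic_smoothing (t : ℝ) (w : (Fin n → ℝ) × (Fin n → ℝ)) (r : Fin n → ℝ) :
    Integrable (fun v => quartic a (bilin a (t • v + w) - r)) (laplacePair n) :=
  (AllMoments.quartic a fun k => (allMoments_bilin_smul_add a t w k).sub
    (AllMoments.const (r k))).integrable

lemma exists_second_net {p : ℝ} (hp : 1 ≤ p) (W : Set ((Fin n → ℝ) × (Fin n → ℝ)))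
    (hW : W ⊆ enlargedBall n p ×ˢ enlargedBall n p)
    (h1 : ∀ w ∈ W, rowQuartic a w.1 ≤ firstRadius a p)
    (h2 : ∀ w ∈ W, rowQuartic (swapArray a) w.2 ≤ firstRadius a p) :
    ∃ F : Finset ((Fin n → ℝ) × (Fin n → ℝ)), ↑F ⊆ W ∧ (F.card : ℝ) ≤ Real.exp (26 * p) ∧
      ∀ w ∈ W, ∃ c ∈ F, quartic a (bilin a w - bilin a c) ≤ secondRadius a p := by
  -- Taking the image of `w` itself as reference kills the first term of the smoothing bound.
  obtain ⟨F, hFW, hFc, hF⟩ := exists_finset_net_of_integral_le hp W hW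
    (fun w v => quartic a (bilin a v - bilin a w)) (fun w => by fun_prop)
    (fun w v => quartic_nonneg _ _)
    (M := 8256 * (momentConst ^ 2 * (∑ k, sliceNorm a k) / p ^ 4))
    (fun w _ => integrable_quartic_smoothing a _ _ _)
    (fun w hw => by
      refine (integral_quartic_smoothing_le a hp (h1 w hw) (h2 w hw) _).trans (le_of_eq ?_)
      simp [quartic])
  refine ⟨F, hFW, hFc, fun w hw => ?_⟩
  obtain ⟨c, hc, v, e1, e2⟩ := hF w hw
  refine ⟨c, hc, (quartic_sub_le a _ (bilin a v) _).trans ?_⟩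
  have h0 : 0 ≤ momentConst ^ 2 * (∑ k, sliceNorm a k) / p ^ 4 := by
    have := Finset.sum_nonneg fun k (_ : k ∈ Finset.univ) => sliceNorm_nonneg a k
    positivity
  rw [secondRadius]
  linarith

end Nets

/-! ### Gaussian averages -/

instance isProbabilityMeasure_gaussianVec (n : ℕ) : IsProbabilityMeasure (gaussianVec n) := by
  unfold gaussianVec; infer_instance

/-- The compensator `h²/2` is the Gaussian cumulant, so each independent factor has mean exactly
one. -/
lemma lintegral_exp_gaussianVec {n : ℕ} (h : Fin n → ℝ) :
    ∫⁻ g, ENNReal.ofReal (Real.exp (∑ k, (h k * g k - h k ^ 2 / 2))) ∂gaussianVec n = 1 := by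
  have h1 (k : Fin n) : Integrable (fun y => Real.exp (h k * y - h k ^ 2 / 2))
      (gaussianReal 0 1) := by
    simp only [Real.exp_sub]
    exact (integrable_exp_mul_gaussianReal _).div_const _
  have h2 (k : Fin n) : ∫ y, Real.exp (h k * y - h k ^ 2 / 2) ∂gaussianReal 0 1 = 1 := by
    simp only [Real.exp_sub]
    rw [integral_div]
    have := congrFun (mgf_fun_id_gaussianReal (μ := 0) (v := 1)) (h k)
    simp only [mgf, zero_mul, NNReal.coe_one, one_mul, zero_add] at this
    rw [this, div_self (Real.exp_pos _).ne']
  simp only [Real.exp_sum]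
  rw [gaussianVec, ← ofReal_integral_eq_lintegral_ofReal
    (Integrable.fintype_prod (μ := fun _ : Fin n => gaussianReal 0 1)
      (f := fun k y => Real.exp (h k * y - h k ^ 2 / 2)) h1)
    (Filter.Eventually.of_forall fun g => Finset.prod_nonneg fun k _ => (Real.exp_pos _).le),
    integral_fintype_prod_eq_prod (μ := fun _ : Fin n => gaussianReal 0 1)
      (fun k y => Real.exp (h k * y - h k ^ 2 / 2))]
  simp [h2]

lemma integrable_eval_gaussianVec {n : ℕ} (k : Fin n) :
    Integrable (fun g => g k) (gaussianVec n) :=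
  integrable_comp_eval (μ := fun _ : Fin n => gaussianReal 0 1) (f := fun y : ℝ => y)
    (memLp_id_gaussianReal 1 |>.integrable le_rfl)

lemma integral_eval_gaussianVec {n : ℕ} (k : Fin n) : ∫ g, g k ∂gaussianVec n = 0 := by
  rw [gaussianVec, integral_eval (μ := fun _ : Fin n => gaussianReal 0 1)]
  exact integral_id_gaussianReal

section Chaos

variable {n : ℕ} (a : Fin n → Fin n → Fin n → ℝ) (z : Fin n → ℝ)

lemma chaos_eq_sum (g : Fin n → ℝ) (v : (Fin n → ℝ) × (Fin n → ℝ)) :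
    chaos a z g v = ∑ k, z k * bilin a v k * g k := by
  simp only [chaos, bilin, Finset.mul_sum, Finset.sum_mul]
  rw [Finset.sum_congr rfl fun i _ => Finset.sum_comm, Finset.sum_comm]
  refine Finset.sum_congr rfl fun k _ => Finset.sum_congr rfl fun i _ =>
    Finset.sum_congr rfl fun j _ => ?_
  ring

lemma continuous_chaos (v : (Fin n → ℝ) × (Fin n → ℝ)) : Continuous fun g => chaos a z g v := by
  unfold chaos; fun_prop

lemma integrable_chaos (v : (Fin n → ℝ) × (Fin n → ℝ)) :
    Integrable (fun g => chaos a z g v) (gaussianVec n) := by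
  simp only [chaos_eq_sum]
  exact integrable_finsetSum _ fun k _ => (integrable_eval_gaussianVec k).const_mul _

lemma integral_chaos (v : (Fin n → ℝ) × (Fin n → ℝ)) :
    ∫ g, chaos a z g v ∂gaussianVec n = 0 := by
  simp only [chaos_eq_sum]
  rw [integral_finsetSum _ fun k _ => (integrable_eval_gaussianVec k).const_mul _]
  simp [integral_const_mul, integral_eval_gaussianVec]

/-- A pointwise domination of the increments of the chaos bounds the expected supremum. -/
lemma supChaos_of_le {S : Set ((Fin n → ℝ) × (Fin n → ℝ))} {d : (Fin n → ℝ) × (Fin n → ℝ)}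
    (hd : d ∈ S) {X : (Fin n → ℝ) → ℝ} (hX : Integrable X (gaussianVec n))
    (h : ∀ g, ∀ w ∈ S, chaos a z g w ≤ chaos a z g d + X g) :
    (∀ g, BddAbove (chaos a z g '' S)) ∧ Integrable (supChaos a z S) (gaussianVec n) ∧
      ∫ g, supChaos a z S g ∂gaussianVec n ≤ ∫ g, X g ∂gaussianVec n := by
  have hbdd (g : Fin n → ℝ) : BddAbove (chaos a z g '' S) := by
    refine ⟨chaos a z g d + X g, ?_⟩
    rintro _ ⟨w, hw, rfl⟩
    exact h g w hw
  have hle (g : Fin n → ℝ) : supChaos a z S g ≤ chaos a z g d + X g := by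
    refine csSup_le ⟨_, d, hd, rfl⟩ ?_
    rintro _ ⟨w, hw, rfl⟩
    exact h g w hw
  have hge (g : Fin n → ℝ) : chaos a z g d ≤ supChaos a z S g :=
    le_csSup (hbdd g) ⟨d, hd, rfl⟩
  -- The cell may be uncountable; a pointwise bounded supremum of continuous functions is lower
  -- semicontinuous, hence measurable.
  have hmeas : Measurable (supChaos a z S) := by
    have hl : LowerSemicontinuous fun g => ⨆ w : S, chaos a z g w := by
      refine lowerSemicontinuous_ciSup (fun g => ?_) fun w =>
        (continuous_chaos a z w).lowerSemicontinuous
      rw [← Set.image_eq_range]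
      exact hbdd g
    have heq : supChaos a z S = fun g => ⨆ w : S, chaos a z g w := by
      funext g
      rw [supChaos, sSup_image']
    rw [heq]
    exact hl.measurable
  have hint : Integrable (supChaos a z S) (gaussianVec n) := by
    refine Integrable.mono' ((integrable_chaos a z d).abs.add hX) hmeas.aestronglyMeasurable
      (Filter.Eventually.of_forall fun g => ?_)
    have h0 : 0 ≤ X g := by linarith [h g d hd]
    rw [Real.norm_eq_abs, abs_le, Pi.add_apply]
    constructor
    · linarith [hge g, neg_abs_le (chaos a z g d)]
    · linarith [hle g, le_abs_self (chaos a z g d)]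
  refine ⟨hbdd, hint, ?_⟩
  calc ∫ g, supChaos a z S g ∂gaussianVec n
      ≤ ∫ g, (chaos a z g d + X g) ∂gaussianVec n :=
        integral_mono hint ((integrable_chaos a z d).add hX) hle
    _ = ∫ g, X g ∂gaussianVec n := by
        rw [integral_add (integrable_chaos a z d) hX, integral_chaos, zero_add]

/-- The exponential functional of the PAC-Bayesian bound, with parameter `l`, smoothing scale `t`
and reference point `r`. -/
noncomputable def gibbsExponent (l t : ℝ) (r g : Fin n → ℝ)
    (v : (Fin n → ℝ) × (Fin n → ℝ)) : ℝ :=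
  ∑ k, (l * z k * (bilin a (t • v) k - r k) * g k
    - (l * z k * (bilin a (t • v) k - r k)) ^ 2 / 2)

/-- The average of the exponential functional over the smoothing measure. -/
noncomputable def gibbsAverage (l t : ℝ) (r g : Fin n → ℝ) : ENNReal :=
  ∫⁻ v, ENNReal.ofReal (Real.exp (gibbsExponent a z l t r g v)) ∂laplacePair n

lemma measurable_uncurry_gibbsExponent (l t : ℝ) (r : Fin n → ℝ) :
    Measurable fun q : (Fin n → ℝ) × ((Fin n → ℝ) × (Fin n → ℝ)) =>
      ENNReal.ofReal (Real.exp (gibbsExponent a z l t r q.1 q.2)) := by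
  unfold gibbsExponent bilin; fun_prop

lemma measurable_gibbsAverage (l t : ℝ) (r : Fin n → ℝ) :
    Measurable (gibbsAverage a z l t r) :=
  (measurable_uncurry_gibbsExponent a z l t r).lintegral_prod_right'

/-- Exchanging the integrals, the Gaussian mean is already 1 for each fixed `v`. -/
lemma lintegral_gibbsAverage (l t : ℝ) (r : Fin n → ℝ) :
    ∫⁻ g, gibbsAverage a z l t r g ∂gaussianVec n = 1 := by
  unfold gibbsAverage
  rw [lintegral_lintegral_swap (measurable_uncurry_gibbsExponent a z l t r).aemeasurable]
  unfold gibbsExponent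
  simp only [lintegral_exp_gaussianVec]
  simp

/-- Completing the square bounds `hg - h²/2` by `g²/2`, uniformly in `v`. -/
lemma gibbsAverage_ne_top (l t : ℝ) (r g : Fin n → ℝ) : gibbsAverage a z l t r g ≠ ⊤ := by
  refine ne_top_of_le_ne_top (b := ENNReal.ofReal (Real.exp (∑ k, g k ^ 2 / 2)))
    ENNReal.ofReal_ne_top ?_
  calc gibbsAverage a z l t r g
      ≤ ∫⁻ _v, ENNReal.ofReal (Real.exp (∑ k, g k ^ 2 / 2)) ∂laplacePair n := by
        refine lintegral_mono fun v => ENNReal.ofReal_le_ofReal (Real.exp_le_exp.2 ?_)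
        refine Finset.sum_le_sum fun k _ => ?_
        nlinarith [sq_nonneg (l * z k * (bilin a (t • v) k - r k) - g k)]
    _ = _ := by simp

lemma integrable_toReal_gibbsAverage (l t : ℝ) (r : Fin n → ℝ) :
    Integrable (fun g => (gibbsAverage a z l t r g).toReal) (gaussianVec n) :=
  integrable_toReal_of_lintegral_ne_top (measurable_gibbsAverage a z l t r).aemeasurable
    (by rw [lintegral_gibbsAverage]; simp)

lemma integral_toReal_gibbsAverage (l t : ℝ) (r : Fin n → ℝ) :
    ∫ g, (gibbsAverage a z l t r g).toReal ∂gaussianVec n = 1 := by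
  rw [integral_toReal (measurable_gibbsAverage a z l t r).aemeasurable
    (Filter.Eventually.of_forall fun g => (gibbsAverage_ne_top a z l t r g).lt_top),
    lintegral_gibbsAverage]
  simp

/-- The PAC-Bayesian bound for the increments of the chaos. -/
lemma mul_chaos_sub_le {p : ℝ} (hp : 1 ≤ p) (l : ℝ) (g : Fin n → ℝ)
    (d : (Fin n → ℝ) × (Fin n → ℝ)) {w : (Fin n → ℝ) × (Fin n → ℝ)}
    (hw : w ∈ enlargedBall n p ×ˢ enlargedBall n p) {V : ℝ}
    (hV : ∫ v, ∑ k, z k ^ 2 * (bilin a ((Real.sqrt p)⁻¹ • v + w) k - bilin a d k) ^ 2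
      ∂laplacePair n ≤ V) :
    l * (chaos a z g w - chaos a z g d) ≤
      (gibbsAverage a z l (Real.sqrt p)⁻¹ (bilin a d) g).toReal + 12 * p + l ^ 2 * V / 2 := by
  set t := (Real.sqrt p)⁻¹ with ht
  have hshift (v : (Fin n → ℝ) × (Fin n → ℝ)) : t • (v + Real.sqrt p • w) = t • v + w :=
    inv_sqrt_smul_add_sqrt_smul (by linarith) v w
  have hb (k : Fin n) := (allMoments_bilin_smul_add a t w k).sub (AllMoments.const (bilin a d k))
  have hexp (v : (Fin n → ℝ) × (Fin n → ℝ)) :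
      gibbsExponent a z l t (bilin a d) g (v + Real.sqrt p • w)
      = ∑ k, (l * z k * g k) * (bilin a (t • v + w) k - bilin a d k)
        - l ^ 2 / 2 * ∑ k, z k ^ 2 * (bilin a (t • v + w) k - bilin a d k) ^ 2 := by
    rw [gibbsExponent, Finset.mul_sum, ← Finset.sum_sub_distrib]
    refine Finset.sum_congr rfl fun k _ => ?_
    rw [hshift]
    ring
  have m1 : AllMoments (laplacePair n) fun v =>
      ∑ k, (l * z k * g k) * (bilin a (t • v + w) k - bilin a d k) :=
    AllMoments.sum _ fun k _ => (hb k).const_mul _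
  have m2 : AllMoments (laplacePair n) fun v =>
      ∑ k, z k ^ 2 * (bilin a (t • v + w) k - bilin a d k) ^ 2 :=
    AllMoments.sum _ fun k _ => ((hb k).pow 2).const_mul _
  -- Centred smoothing preserves bilinear forms in the mean, so the linear part recovers the
  -- increment exactly.
  have i1 : ∫ v, ∑ k, (l * z k * g k) * (bilin a (t • v + w) k - bilin a d k) ∂laplacePair n
      = l * (chaos a z g w - chaos a z g d) := by
    rw [integral_finsetSum _ fun k _ => ((hb k).const_mul _).integrable, chaos_eq_sum,
      chaos_eq_sum, ← Finset.sum_sub_distrib, Finset.mul_sum]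
    refine Finset.sum_congr rfl fun k _ => ?_
    rw [integral_const_mul, integral_sub (allMoments_bilin_smul_add a t w k).integrable
      (integrable_const _), integral_bilin_smul_add]
    simp
    ring
  have hmeas : Measurable (gibbsExponent a z l t (bilin a d) g) := by
    unfold gibbsExponent bilin; fun_prop
  have key := exp_integral_sub_integral_pairCost_le (Real.sqrt p • w)
    (gibbsExponent a z l t (bilin a d) g) hmeas (by
      simp only [hexp]
      exact (m1.sub (m2.const_mul _)).integrable)
  have hcost := integral_pairCost_sqrt_smul_le (by linarith : 0 ≤ p) hw
  simp only [hexp] at key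
  rw [integral_sub m1.integrable (m2.const_mul _).integrable, integral_const_mul, i1] at key
  have key' := (ENNReal.ofReal_le_iff_le_toReal (gibbsAverage_ne_top a z l t (bilin a d) g)).1 key
  -- The bound `x ≤ exp x` replaces the logarithm of `gibbsAverage` by `gibbsAverage` itself, whose
  -- Gaussian mean is only 1.
  have := Real.add_one_le_exp (l * (chaos a z g w - chaos a z g d)
    - l ^ 2 / 2 * ∫ v, ∑ k, z k ^ 2 * (bilin a (t • v + w) k - bilin a d k) ^ 2 ∂laplacePair n
    - ∫ v, pairCost (Real.sqrt p • w) v ∂laplacePair n)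
  have hlV : l ^ 2 / 2 * ∫ v, ∑ k, z k ^ 2 * (bilin a (t • v + w) k - bilin a d k) ^ 2
      ∂laplacePair n ≤ l ^ 2 / 2 * V := by gcongr
  linarith

/-- Cauchy-Schwarz in additive form: with `η` free, the right side is linear in `quartic` and can be
averaged over the smoothing law before optimising. -/
lemma sum_sq_mul_sq_le {η : ℝ} (hη : 0 < η) {r : Fin n → ℝ}
    (hr : ∀ k, sliceNorm a k = 0 → r k = 0) :
    ∑ k, z k ^ 2 * r k ^ 2
      ≤ (η * ∑ k, z k ^ 4 * sliceNorm a k + quartic a r / η) / 2 := by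
  rw [quartic, Finset.mul_sum, Finset.sum_div, ← Finset.sum_add_distrib, Finset.sum_div]
  refine Finset.sum_le_sum fun k _ => ?_
  rcases (sliceNorm_nonneg a k).eq_or_lt with h | h
  · simp [← h, hr k h.symm]
  · have h1 := two_mul_le_add_sq (η * z k ^ 2 * sliceNorm a k) (r k ^ 2)
    have h2 : η * (z k ^ 4 * sliceNorm a k) + r k ^ 4 / sliceNorm a k / η
        = ((η * z k ^ 2 * sliceNorm a k) ^ 2 + (r k ^ 2) ^ 2) / (η * sliceNorm a k) := by
      field_simp
    rw [h2, le_div_iff₀ (by norm_num), le_div_iff₀ (by positivity)]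
    linarith

end Chaos

/-! ### The expected supremum over a cell of the partition -/

section Cells

variable {n : ℕ} (a : Fin n → Fin n → Fin n → ℝ)

/-- The constant in the bound for the smoothed weighted fourth power on a cell. -/
@[irreducible] noncomputable def cellConst : ℝ := 10 ^ 8 * momentConst ^ 2

lemma one_le_cellConst : 1 ≤ cellConst := by norm_num [cellConst, momentConst]

lemma integral_sum_sq_smoothing_le {p : ℝ} (hp : 1 ≤ p) (z : Fin n → ℝ)
    {w d : (Fin n → ℝ) × (Fin n → ℝ)} (h1 : rowQuartic a w.1 ≤ firstRadius a p)
    (h2 : rowQuartic (swapArray a) w.2 ≤ firstRadius a p)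
    (h3 : quartic a (bilin a w - bilin a d) ≤ secondRadius a p)
    (hA : 0 < ∑ k, sliceNorm a k) (hZ : 0 < ∑ k, z k ^ 4 * sliceNorm a k) :
    ∫ v, ∑ k, z k ^ 2 * (bilin a ((Real.sqrt p)⁻¹ • v + w) k - bilin a d k) ^ 2 ∂laplacePair n
      ≤ cellConst * (Real.sqrt (∑ k, z k ^ 4 * sliceNorm a k)
          * Real.sqrt (∑ k, sliceNorm a k)) / p ^ 2 := by
  set A := ∑ k, sliceNorm a k with hAdef
  set Z := ∑ k, z k ^ 4 * sliceNorm a k with hZdef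
  have hp0 : 0 < p := by linarith
  have hsA := Real.sqrt_pos.2 hA
  have hsZ := Real.sqrt_pos.2 hZ
  have hA2 : Real.sqrt A ^ 2 = A := Real.sq_sqrt hA.le
  have hZ2 : Real.sqrt Z ^ 2 = Z := Real.sq_sqrt hZ.le
  have hη : 0 < Real.sqrt A / (Real.sqrt Z * p ^ 2) :=
    div_pos hsA (mul_pos hsZ (pow_pos hp0 2))
  -- Balances `η Z` against `(A / p⁴) / η`; both equal `√Z √A / p²`.
  set η := Real.sqrt A / (Real.sqrt Z * p ^ 2) with hηdef
  have hiq := integrable_quartic_smoothing a (Real.sqrt p)⁻¹ w (bilin a d)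
  have hq : ∫ v, quartic a (bilin a ((Real.sqrt p)⁻¹ • v + w) - bilin a d) ∂laplacePair n
      ≤ cellConst * (A / p ^ 4) := by
    refine (integral_quartic_smoothing_le a hp h1 h2 (bilin a d)).trans ?_
    have h0 : 0 ≤ momentConst ^ 2 * A / p ^ 4 := by positivity
    -- The factor `10⁸` absorbs `64 · 10⁶` from `secondRadius` plus 8256.
    have e : cellConst * (A / p ^ 4) = 10 ^ 8 * (momentConst ^ 2 * A / p ^ 4) := by
      rw [cellConst]; ring
    rw [secondRadius, ← hAdef] at h3
    rw [e]
    linarith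
  have hi : Integrable (fun v => ∑ k, z k ^ 2
      * (bilin a ((Real.sqrt p)⁻¹ • v + w) k - bilin a d k) ^ 2) (laplacePair n) :=
    (AllMoments.sum _ fun k _ => (((allMoments_bilin_smul_add a _ w k).sub
      (AllMoments.const (bilin a d k))).pow 2).const_mul _).integrable
  calc ∫ v, ∑ k, z k ^ 2 * (bilin a ((Real.sqrt p)⁻¹ • v + w) k - bilin a d k) ^ 2
        ∂laplacePair n
      ≤ ∫ v, (η * Z + quartic a (bilin a ((Real.sqrt p)⁻¹ • v + w) - bilin a d) / η) / 2
          ∂laplacePair n := by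
        refine integral_mono hi (((integrable_const _).add (hiq.div_const _)).div_const _)
          fun v => sum_sq_mul_sq_le a z hη
            (r := bilin a ((Real.sqrt p)⁻¹ • v + w) - bilin a d) fun k hk => ?_
        rw [Pi.sub_apply, bilin_eq_zero_of_sliceNorm_eq_zero a hk,
          bilin_eq_zero_of_sliceNorm_eq_zero a hk, sub_zero]
    _ = (η * Z + (∫ v, quartic a (bilin a ((Real.sqrt p)⁻¹ • v + w) - bilin a d)
          ∂laplacePair n) / η) / 2 := by
        rw [integral_div, integral_add (integrable_const _) (hiq.div_const _), integral_div]
        simp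
    _ ≤ (η * Z + cellConst * (A / p ^ 4) / η) / 2 :=
        div_le_div_of_nonneg_right (add_le_add_right (div_le_div_of_nonneg_right hq hη.le) _)
          zero_le_two
    _ = (1 + cellConst) * (Real.sqrt Z * Real.sqrt A) / p ^ 2 / 2 := by
        have e1 : η * Z = Real.sqrt Z * Real.sqrt A / p ^ 2 := by
          rw [hηdef]; nth_rewrite 2 [← hZ2]; field_simp
        have e2 : cellConst * (A / p ^ 4) / η
            = cellConst * (Real.sqrt Z * Real.sqrt A) / p ^ 2 := by
          rw [hηdef]; nth_rewrite 1 [← hA2]; field_simp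
        rw [e1, e2]
        ring
    _ ≤ cellConst * (Real.sqrt Z * Real.sqrt A) / p ^ 2 := by
        have h0 : 0 ≤ Real.sqrt Z * Real.sqrt A / p ^ 2 :=
          div_nonneg (mul_nonneg hsZ.le hsA.le) (sq_nonneg p)
        have := mul_le_mul_of_nonneg_right one_le_cellConst h0
        have e (x : ℝ) : x * (Real.sqrt Z * Real.sqrt A) / p ^ 2
            = x * (Real.sqrt Z * Real.sqrt A / p ^ 2) := by ring
        rw [e, e]
        linarith

lemma chaos_eq_zero {z : Fin n → ℝ}
    (h : (∑ k, z k ^ 4 * sliceNorm a k) * ∑ k, sliceNorm a k = 0) (g : Fin n → ℝ)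
    (v : (Fin n → ℝ) × (Fin n → ℝ)) : chaos a z g v = 0 := by
  rw [chaos_eq_sum]
  refine Finset.sum_eq_zero fun k _ => ?_
  have hk : z k = 0 ∨ sliceNorm a k = 0 := by
    rcases mul_eq_zero.1 h with h | h
    · have := (Finset.sum_eq_zero_iff_of_nonneg fun k _ =>
        mul_nonneg (by positivity) (sliceNorm_nonneg a k)).1 h k (Finset.mem_univ k)
      simpa using this
    · exact Or.inr ((Finset.sum_eq_zero_iff_of_nonneg fun k _ => sliceNorm_nonneg a k).1 h k
        (Finset.mem_univ k))
  rcases hk with hk | hk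
  · simp [hk]
  · simp [bilin_eq_zero_of_sliceNorm_eq_zero a hk]

/-- The expected supremum of the chaos over a cell. -/
lemma supChaos_cell {p : ℝ} (hp : 1 ≤ p) (z : Fin n → ℝ)
    {S : Set ((Fin n → ℝ) × (Fin n → ℝ))} (hS : S ⊆ enlargedBall n p ×ˢ enlargedBall n p)
    {d : (Fin n → ℝ) × (Fin n → ℝ)} (hd : d ∈ S)
    (h1 : ∀ w ∈ S, rowQuartic a w.1 ≤ firstRadius a p)
    (h2 : ∀ w ∈ S, rowQuartic (swapArray a) w.2 ≤ firstRadius a p)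
    (h3 : ∀ w ∈ S, quartic a (bilin a w - bilin a d) ≤ secondRadius a p) :
    (∀ g, BddAbove (chaos a z g '' S)) ∧ Integrable (supChaos a z S) (gaussianVec n) ∧
      ∫ g, supChaos a z S g ∂gaussianVec n ≤ (13 + cellConst) / Real.sqrt p
        * Real.sqrt (Real.sqrt (∑ k, z k ^ 4 * sliceNorm a k) * Real.sqrt (∑ k, sliceNorm a k)) := by
  have hC := one_le_cellConst
  have hA0 : 0 ≤ ∑ k, sliceNorm a k := Finset.sum_nonneg fun k _ => sliceNorm_nonneg a k
  have hZ0 : 0 ≤ ∑ k, z k ^ 4 * sliceNorm a k :=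
    Finset.sum_nonneg fun k _ => mul_nonneg (by positivity) (sliceNorm_nonneg a k)
  rcases (mul_nonneg hZ0 hA0).eq_or_lt with h0 | h0
  -- If either factor vanishes the chaos is identically zero, and the optimal parameter below would
  -- be undefined.
  · obtain ⟨b1, b2, b3⟩ := supChaos_of_le a z hd (X := fun _ => 0) (integrable_const _)
      fun g w _ => by simp [chaos_eq_zero a h0.symm]
    refine ⟨b1, b2, b3.trans ?_⟩
    rw [integral_zero]
    positivity
  have hA : 0 < ∑ k, sliceNorm a k := pos_of_mul_pos_right h0 hZ0
  have hZ : 0 < ∑ k, z k ^ 4 * sliceNorm a k := pos_of_mul_pos_left h0 hA0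
  have hp0 : 0 < p := by linarith
  set E := Real.sqrt (∑ k, z k ^ 4 * sliceNorm a k) * Real.sqrt (∑ k, sliceNorm a k) with hE
  have hE0 : 0 < E := mul_pos (Real.sqrt_pos.2 hZ) (Real.sqrt_pos.2 hA)
  have hD : 0 < Real.sqrt E := Real.sqrt_pos.2 hE0
  have hD2 : Real.sqrt E ^ 2 = E := Real.sq_sqrt hE0.le
  have hq : 0 < Real.sqrt p := Real.sqrt_pos.2 hp0
  have hq2 : Real.sqrt p ^ 2 = p := Real.sq_sqrt hp0.le
  -- With variance of order `E/p²`, this choice makes the quadratic term of order `p`, like the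
  -- entropy cost; dividing by `l` leaves `√E / √p`.
  set l := p * Real.sqrt p / Real.sqrt E with hl
  have hl0 : 0 < l := div_pos (mul_pos hp0 hq) hD
  have hlV : l ^ 2 * (cellConst * E / p ^ 2) / 2 = cellConst * p / 2 := by
    rw [hl, div_pow, mul_pow, hq2, hD2]
    field_simp
  have hi := integrable_toReal_gibbsAverage a z l (Real.sqrt p)⁻¹ (bilin a d)
  obtain ⟨b1, b2, b3⟩ := supChaos_of_le a z hd
    (X := fun g => l⁻¹ * ((gibbsAverage a z l (Real.sqrt p)⁻¹ (bilin a d) g).toReal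
      + (12 * p + cellConst * p / 2))) ((hi.add (integrable_const _)).const_mul _)
    fun g w hw => by
      have key := mul_chaos_sub_le a z hp l g d (hS hw)
        (integral_sum_sq_smoothing_le a hp z (h1 w hw) (h2 w hw) (h3 w hw) hA hZ)
      rw [← hE, hlV] at key
      have : chaos a z g w - chaos a z g d ≤
          l⁻¹ * ((gibbsAverage a z l (Real.sqrt p)⁻¹ (bilin a d) g).toReal
            + (12 * p + cellConst * p / 2)) := by
        rw [le_inv_mul_iff₀ hl0]
        linarith
      linarith
  refine ⟨b1, b2, b3.trans ?_⟩
  rw [integral_const_mul, integral_add hi (integrable_const _), integral_toReal_gibbsAverage]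
  simp only [integral_const, probReal_univ, one_smul]
  calc l⁻¹ * (1 + (12 * p + cellConst * p / 2)) ≤ l⁻¹ * ((13 + cellConst) * p) := by
        refine mul_le_mul_of_nonneg_left ?_ (inv_nonneg.2 hl0.le)
        linarith [mul_nonneg (by linarith : 0 ≤ cellConst) hp0.le]
    _ = (13 + cellConst) / Real.sqrt p * Real.sqrt E := by
        rw [hl]
        field_simp

lemma rpow_one_div_four {x : ℝ} (hx : 0 ≤ x) : x ^ (1 / 4 : ℝ) = Real.sqrt (Real.sqrt x) := by
  rw [Real.sqrt_eq_rpow, Real.sqrt_eq_rpow, ← Real.rpow_mul hx]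
  norm_num

lemma sum_sq_mul_eq_sum_sliceNorm (f : Fin n → ℝ) :
    ∑ i, ∑ j, ∑ k, a i j k ^ 2 * f k = ∑ k, f k * sliceNorm a k := by
  simp only [sliceNorm, Finset.mul_sum]
  rw [Finset.sum_congr rfl fun i _ => Finset.sum_comm, Finset.sum_comm]
  exact Finset.sum_congr rfl fun k _ => Finset.sum_congr rfl fun i _ =>
    Finset.sum_congr rfl fun j _ => mul_comm _ _

end Cells

end ChaosPartition

open ChaosPartition in
theorem mainTheorem7 :
    ∃ L : ℝ, 0 < L ∧
      ∀ (n : ℕ) (a : Fin n → Fin n → Fin n → ℝ) (p : ℝ), 1 ≤ p →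
      ∀ T : Set ((Fin n → ℝ) × (Fin n → ℝ)),
        T ⊆ ChaosPartition.mixedBall n p ×ˢ ChaosPartition.mixedBall n p →
        ∃ (N : ℕ) (S : Fin N → Set ((Fin n → ℝ) × (Fin n → ℝ)))
          (c : Fin N → (Fin n → ℝ) × (Fin n → ℝ)),
          (N : ℝ) ≤ Real.exp (L * p) ∧
          (∀ l, c l ∈ T) ∧
          (∀ l, (S l).Nonempty) ∧
          T = ⋃ l, (fun v => v + c l) '' S l ∧
          ∀ (l : Fin N) (z : Fin n → ℝ),
            (∀ g : Fin n → ℝ, BddAbove (ChaosPartition.chaos a z g '' S l)) ∧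
            Integrable (ChaosPartition.supChaos a z (S l)) (ChaosPartition.gaussianVec n) ∧
            ∫ g, ChaosPartition.supChaos a z (S l) g ∂(ChaosPartition.gaussianVec n) ≤
              L / Real.sqrt p
                * (∑ i, ∑ j, ∑ k, a i j k ^ 2 * z k ^ 4) ^ (1 / 4 : ℝ)
                * (∑ i, ∑ j, ∑ k, a i j k ^ 2) ^ (1 / 4 : ℝ) := by
  have hC := one_le_cellConst
  -- The two nets contribute `26 + 26 = 52` to the exponent, and the constant also exceeds the `13 +
  -- cellConst` of the supremum bound.
  refine ⟨52 + cellConst, by linarith, fun n a p hp T hT => ?_⟩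
  obtain ⟨F, hFT, hFc, hF⟩ := exists_first_net a hp T (hT.trans
    (Set.prod_mono (mixedBall_subset_enlargedBall n p) (mixedBall_subset_enlargedBall n p)))
  -- Requiring `w + c ∈ T` makes the translated cells cover `T` exactly. Recentred points are
  -- differences of points of `mixedBall`, hence the enlarged ball.
  let W : (Fin n → ℝ) × (Fin n → ℝ) → Set ((Fin n → ℝ) × (Fin n → ℝ)) := fun c =>
    {w | w ∈ enlargedBall n p ×ˢ enlargedBall n p ∧ w + c ∈ T ∧
      rowQuartic a w.1 ≤ firstRadius a p ∧ rowQuartic (swapArray a) w.2 ≤ firstRadius a p}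
  choose G hGW hGc hG using fun c => exists_second_net a hp (W c) (fun w hw => hw.1)
    (fun w hw => hw.2.2.1) (fun w hw => hw.2.2.2)
  -- A cell is indexed by a first centre and a second centre attached to it. Only the first is used
  -- as the translation; the second stays in the cell as the reference point for the chaos.
  let I := F.sigma G
  let e := I.equivFin
  let S : Fin I.card → Set ((Fin n → ℝ) × (Fin n → ℝ)) := fun l =>
    {w | w ∈ W (e.symm l).1.1 ∧
      quartic a (bilin a w - bilin a (e.symm l).1.2) ≤ secondRadius a p}
  have hmemF (l : Fin I.card) : (e.symm l).1.1 ∈ F := (Finset.mem_sigma.1 (e.symm l).2).1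
  have hmemG (l : Fin I.card) : (e.symm l).1.2 ∈ G (e.symm l).1.1 :=
    (Finset.mem_sigma.1 (e.symm l).2).2
  have hR : 0 ≤ secondRadius a p := by
    have := Finset.sum_nonneg fun k (_ : k ∈ Finset.univ) => sliceNorm_nonneg a k
    unfold secondRadius
    positivity
  have hdS (l : Fin I.card) : (e.symm l).1.2 ∈ S l :=
    ⟨hGW _ (hmemG l), by simpa [quartic] using hR⟩
  refine ⟨I.card, S, fun l => (e.symm l).1.1, ?_, fun l => hFT (hmemF l),
    fun l => ⟨_, hdS l⟩, ?_, fun l z => ?_⟩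
  · calc (I.card : ℝ) = ∑ c ∈ F, ((G c).card : ℝ) := by rw [Finset.card_sigma]; push_cast; rfl
      _ ≤ ∑ _c ∈ F, Real.exp (26 * p) := Finset.sum_le_sum fun c _ => hGc c
      _ = F.card * Real.exp (26 * p) := by simp
      _ ≤ Real.exp (26 * p) * Real.exp (26 * p) := by gcongr
      _ ≤ Real.exp ((52 + cellConst) * p) := by
          rw [← Real.exp_add]
          exact Real.exp_le_exp.2 (by nlinarith)
  · refine Set.Subset.antisymm (fun w hw => ?_) (Set.iUnion_subset fun l => ?_)
    · obtain ⟨c, hc, h1, h2⟩ := hF w hw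
      have hwW : w - c ∈ W c := by
        refine ⟨⟨sub_mem_enlargedBall (hT hw).1 (hT (hFT hc)).1,
          sub_mem_enlargedBall (hT hw).2 (hT (hFT hc)).2⟩, ?_, h1, h2⟩
        rwa [sub_add_cancel]
      obtain ⟨d, hd, h3⟩ := hG c _ hwW
      have hI : (⟨c, d⟩ : Σ _ : (Fin n → ℝ) × (Fin n → ℝ), (Fin n → ℝ) × (Fin n → ℝ)) ∈ I :=
        Finset.mem_sigma.2 ⟨hc, hd⟩
      refine Set.mem_iUnion.2 ⟨e ⟨_, hI⟩, w - c, ?_, ?_⟩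
      · change w - c ∈ W (e.symm (e ⟨_, hI⟩)).1.1 ∧ _
        rw [Equiv.symm_apply_apply]
        exact ⟨hwW, h3⟩
      · simp only [Equiv.symm_apply_apply, sub_add_cancel]
    · rintro _ ⟨w, hw, rfl⟩
      exact hw.1.2.1
  · obtain ⟨b1, b2, b3⟩ := supChaos_cell a hp z (fun w hw => hw.1.1) (hdS l)
      (fun w hw => hw.1.2.2.1) (fun w hw => hw.1.2.2.2) (fun w hw => hw.2)
    refine ⟨b1, b2, b3.trans ?_⟩
    have hA0 : 0 ≤ ∑ k, sliceNorm a k := Finset.sum_nonneg fun k _ => sliceNorm_nonneg a k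
    have hZ0 : 0 ≤ ∑ k, z k ^ 4 * sliceNorm a k :=
      Finset.sum_nonneg fun k _ => mul_nonneg (by positivity) (sliceNorm_nonneg a k)
    have e1 : ∑ i, ∑ j, ∑ k, a i j k ^ 2 = ∑ k, sliceNorm a k := by
      simpa using sum_sq_mul_eq_sum_sliceNorm a fun _ => 1
    rw [sum_sq_mul_eq_sum_sliceNorm a fun k => z k ^ 4, e1, rpow_one_div_four hA0,
      rpow_one_div_four hZ0, Real.sqrt_mul (Real.sqrt_nonneg _), ← mul_assoc]
    refine mul_le_mul_of_nonneg_right (mul_le_mul_of_nonneg_right ?_ (Real.sqrt_nonneg _))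
      (Real.sqrt_nonneg _)
    exact div_le_div_of_nonneg_right (by linarith) (Real.sqrt_nonneg p)
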